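/- Let $0<q<1$. Write $(a;q)_n=\prod_{k=0}^{n-1}(1-aq^k)$, $(a_1,a_2;q)_n=(a_1;q)_n(a_2;q)_n$, $(a;q)_\infty=\prod_{k\ge 0}(1-aq^k)$, $(x)_n=x(x+1)\cdots(x+n-1)$, and $\Gamma_q(x)=\frac{(q;q)_\infty}{(q^x;q)_\infty}(1-q)^{1-x}$ for $x\in\mathbb{C}$, where $1/\Gamma_q(x)$ is read as $0$ at the poles of $\Gamma_q$. All series below converge absolutely. **Two-variable formulas.** Let $b,c\in\mathbb{C}$ be such that none of $c+1$, $2b+c+1$, $b+c+\frac12$ is a pole of $\Gamma_{q^3}$, i.e. $q^{3c+3+3j}$, $q^{6b+3c+3+3j}$ and $q^{3b+3c+3/2+3j}$ are different from $1$ for all integers $j\ge0$. Put $$N(b,c)=(1-q)(q^2+q+1)^{3b+3c+\frac12}\,\Gamma_{q^3}(c+1)\,\Gamma_{q^3}(b+c+\tfrac12)\,\Gamma_{q^3}(2b+c+1),$$ $$C(b,c)=\frac{N(b,c)}{\Gamma_{q^3}(\frac13)\Gamma_{q^3}(\frac23)\Gamma_q(3b+3c+\frac12)},\qquad R(b,c)=\frac{N(b,c)}{\Gamma_{q^3}(\frac12-b)\Gamma_{q^3}(b+\frac12)\Gamma_q(3b+3c+\frac12)}.$$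 (1) We have $$\sum_{n\ge0}\frac{q^{n^2}(1-q^{3b+3c+4n+\frac12})(q^{\frac12-3b},q^{\frac12+3b};q)_n(q^{3b+3c+\frac12};q)_{2n}}{(q;q)_{2n}(q^{3c+3},q^{3+6b+3c};q^3)_n}=C(b,c)\sum_{n\ge0}\frac{q^{n^2}(q^{\frac12-3b},q^{\frac12+3b};q)_n}{(q;q)_{2n}}=R(b,c).$$ (2) If moreover $q^{2b+2c+1}\ne q^{-b-c+3n-\frac12}$ for all integers $n\ge 0$, then $$\sum_{n\ge0}\frac{(-1)^nq^{3bn-b+3cn-c+\frac{5n^2}2-\frac52}P_q(n)(q^{\frac12-3b},q^{3b+\frac12};q)_{2n}(q^{\frac32-3b-3c};q^3)_n(q^{3b+3c+\frac12};q)_n}{(q^{2b+2c+1}-q^{-b-c+3n-\frac12})(q;q)_{4n+2}(q^{3c+3},q^{6b+3c+3};q^3)_n}=C(b,c)\sum_{n\ge0}\frac{q^{4n^2}T_q(n)(q^{\frac12-3b},q^{3b+\frac12};q)_{2n}}{(q;q)_{4n+2}}$$ and $$\sum_{n\ge0}\frac{(-1)^nq^{3bn-b+3cn-c+\frac{5n^2}2}P_q(n)(q^{\frac12-3b},q^{3b+\frac12};q)_{2n}(q^{\frac32-3b-3c};q^3)_n(q^{3b+3c+\frac12};q)_n}{(q^{2b+2c+1}-q^{-b-c+3n-\frac12})(q;q)_{4n+2}(q^{3c+3},q^{6b+3c+3};q^3)_n}=q^{3b+3}R(b,c),$$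 where $T_q(n)=-q^{3b+4n+5/2}-q^{6b+6n+2}+q^{3b+8n+5/2}+q^{3b+8n+7/2}+q^{3b+1/2}-q^{6n+2}$ and $P_q(n)=-q^{6b+3c+4n+6}-q^{9b+6c+5n+9/2}-q^{9b+6c+5n+11/2}-q^{3b+3c+6n+11/2}-q^{9b+3c+6n+11/2}+q^{6b+6c+7n+6}+q^{12b+6c+7n+6}+q^{6b+3c+8n+3}+q^{6b+3c+8n+4}+q^{6b+3c+8n+6}+q^{6b+3c+8n+7}+q^{9b+6c+9n+11/2}-q^{3b+3c+10n+9/2}-q^{9b+3c+10n+9/2}-q^{6b+3c+12n+4}-q^{9b+6c+13n+15/2}+q^{6b+3c+16n+6}+q^{6b+3c+4}-q^{3b+3n+5/2}+q^{3b+7n+9/2}+q^{6b+9n+4}-q^{3b+11n+9/2}-q^{3b+11n+11/2}+q^{9n+4}$. **Specializations.** For every $0<q<1$, $$\sum_{n\ge0}A_n(q)=\sum_{n\ge0}B_n(q)=\frac{(1-q^2)\sqrt{q^4+q^2+1}}{\Gamma_{q^2}(\frac12)\Gamma_{q^6}(\frac12)}=:R_0(q),$$ where $$A_n(q)=\frac{q^{2n^2}(1-q^{8n+1})(q;q^2)_{2n}(q;q^2)_n^2}{(q^2;q^2)_{2n}(q^6;q^6)_n^2},\qquad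 B_n(q)=\frac{(-1)^nq^{5n^2}p_q(n)(q;q^2)_n(q^3;q^6)_n(q;q^2)_{2n}^2}{(q^{2n+1}+1)(q^{4n+1}+1)(q^{4n+2}+1)(q^2;q^2)_{4n}(q^6;q^6)_n^2}$$ and $p_q(n)=q^{2n+1}+q^{4n+1}+q^{4n+2}+q^{6n+2}+q^{6n+3}+q^{8n+2}+q^{8n+3}-q^{10n+1}+q^{10n+4}-q^{12n+2}-q^{12n+3}-q^{14n+2}-q^{14n+3}-q^{16n+3}-q^{16n+4}-q^{18n+4}-q^{20n+5}+1$. **Classical limits.** These are $q$-analogues of the classical series $$\sum_{n\ge0}\Big(\frac19\Big)^n\frac{(\frac12)_n(\frac14)_n(\frac34)_n}{(1)_n^3}(8n+1)=\frac{2\sqrt3}{\pi},\qquad \sum_{n\ge0}\Big(-\frac1{48}\Big)^n\frac{(\frac12)_n(\frac14)_n(\frac34)_n}{(1)_n^3}(28n+3)=\frac{16}{\sqrt3\,\pi}:$$ both classical evaluations hold and, as $q\to1^-$, for each fixed $n\ge 0$ the quotients $\frac{A_n(q)}{1-q}$ and $\frac{B_n(q)}{1-q}$ tend respectively to the $n$-th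 term of the first series and to $\frac38$ times the $n$-th term of the second, while $\frac{R_0(q)}{1-q}\to\frac{2\sqrt3}{\pi}$. -/

import Mathlib

open Filter Topology

noncomputable section

/-- The finite `q`-Pochhammer symbol `(a; q)_n = ∏_{0 ≤ k < n} (1 - a q^k)`. -/
def qPoch (a q : ℂ) (n : ℕ) : ℂ :=
  ∏ k ∈ Finset.range n, (1 - a * q ^ k)

/-- The infinite `q`-Pochhammer symbol `(a; q)_∞`. -/
def qPochInf (a q : ℂ) : ℂ :=
  ∏' k : ℕ, (1 - a * q ^ k)

/-- The `q`-gamma function `Γ_q(x) = (q; q)_∞ / (q^x; q)_∞ * (1 - q)^(1 - x)`, for `0 < q < 1`.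
At a pole of `Γ_q` (where `(q^x; q)_∞ = 0`) both this value and its inverse are `0`; the latter is
the value of the entire function `1 / Γ_q`. -/
def qGamma (q : ℝ) (x : ℂ) : ℂ :=
  qPochInf q q / qPochInf ((q : ℂ) ^ x) q * ((1 - q : ℝ) : ℂ) ^ (1 - x)

/-- The Pochhammer symbol `(x)_n = x (x + 1) ⋯ (x + n - 1)`. -/
def poch (x : ℝ) (n : ℕ) : ℝ :=
  (ascPochhammer ℝ n).eval x

/-- Summand of the two-variable `q`-analogue of the `8n+1` series. -/
def termA (q : ℝ) (b c : ℂ) (n : ℕ) : ℂ :=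
  (q : ℂ) ^ (n ^ 2) * (1 - (q : ℂ) ^ (3 * b + 3 * c + 4 * n + 1 / 2)) *
    (qPoch ((q : ℂ) ^ (1 / 2 - 3 * b)) q n * qPoch ((q : ℂ) ^ (1 / 2 + 3 * b)) q n) *
    qPoch ((q : ℂ) ^ (3 * b + 3 * c + 1 / 2)) q (2 * n) /
  (qPoch q q (2 * n) *
    (qPoch ((q : ℂ) ^ (3 * c + 3)) (q ^ 3) n * qPoch ((q : ℂ) ^ (3 + 6 * b + 3 * c)) (q ^ 3) n))

/-- Summand of the auxiliary one-variable series attached to `termA`. -/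
def auxA (q : ℝ) (b : ℂ) (n : ℕ) : ℂ :=
  (q : ℂ) ^ (n ^ 2) *
    (qPoch ((q : ℂ) ^ (1 / 2 - 3 * b)) q n * qPoch ((q : ℂ) ^ (1 / 2 + 3 * b)) q n) /
  qPoch q q (2 * n)

/-- The polynomial factor `P_q(n)` in the two-variable `q`-analogue of the `28n+3` series
(all powers are complex powers). -/
def polyB (q b c n : ℂ) : ℂ :=
    -q ^ (6 * b + 3 * c + 4 * n + 6) - q ^ (9 * b + 6 * c + 5 * n + 9 / 2)
      - q ^ (9 * b + 6 * c + 5 * n + 11 / 2) - q ^ (3 * b + 3 * c + 6 * n + 11 / 2)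
      - q ^ (9 * b + 3 * c + 6 * n + 11 / 2) + q ^ (6 * b + 6 * c + 7 * n + 6)
      + q ^ (12 * b + 6 * c + 7 * n + 6) + q ^ (6 * b + 3 * c + 8 * n + 3)
      + q ^ (6 * b + 3 * c + 8 * n + 4) + q ^ (6 * b + 3 * c + 8 * n + 6)
      + q ^ (6 * b + 3 * c + 8 * n + 7) + q ^ (9 * b + 6 * c + 9 * n + 11 / 2)
      - q ^ (3 * b + 3 * c + 10 * n + 9 / 2) - q ^ (9 * b + 3 * c + 10 * n + 9 / 2)
      - q ^ (6 * b + 3 * c + 12 * n + 4) - q ^ (9 * b + 6 * c + 13 * n + 15 / 2)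
      + q ^ (6 * b + 3 * c + 16 * n + 6) + q ^ (6 * b + 3 * c + 4) - q ^ (3 * b + 3 * n + 5 / 2)
      + q ^ (3 * b + 7 * n + 9 / 2) + q ^ (6 * b + 9 * n + 4) - q ^ (3 * b + 11 * n + 9 / 2)
      - q ^ (3 * b + 11 * n + 11 / 2) + q ^ (9 * n + 4)

/-- Summand of the two-variable `q`-analogue of the `28n+3` series. -/
def termB (q : ℝ) (b c : ℂ) (n : ℕ) : ℂ :=
  (-1) ^ n * (q : ℂ) ^ (3 * b * n - b + 3 * c * n - c + 5 * n ^ 2 / 2) * polyB q b c n *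
    (qPoch ((q : ℂ) ^ (1 / 2 - 3 * b)) q (2 * n) * qPoch ((q : ℂ) ^ (3 * b + 1 / 2)) q (2 * n)) *
    qPoch ((q : ℂ) ^ (3 / 2 - 3 * b - 3 * c)) (q ^ 3) n *
    qPoch ((q : ℂ) ^ (3 * b + 3 * c + 1 / 2)) q n /
  (((q : ℂ) ^ (2 * b + 2 * c + 1) - (q : ℂ) ^ (-b - c + 3 * n - 1 / 2)) *
    qPoch q q (4 * n + 2) *
    (qPoch ((q : ℂ) ^ (3 * c + 3)) (q ^ 3) n * qPoch ((q : ℂ) ^ (6 * b + 3 * c + 3)) (q ^ 3) n))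

/-- The polynomial factor of the auxiliary one-variable series attached to `termB`. -/
def auxPolyB (q b n : ℂ) : ℂ :=
    -q ^ (3 * b + 4 * n + 5 / 2) - q ^ (6 * b + 6 * n + 2) + q ^ (3 * b + 8 * n + 5 / 2)
      + q ^ (3 * b + 8 * n + 7 / 2) + q ^ (3 * b + 1 / 2) - q ^ (6 * n + 2)

/-- Summand of the auxiliary one-variable series attached to `termB`. -/
def auxB (q : ℝ) (b : ℂ) (n : ℕ) : ℂ :=
  (q : ℂ) ^ (4 * n ^ 2) * auxPolyB q b n *
    (qPoch ((q : ℂ) ^ (1 / 2 - 3 * b)) q (2 * n) * qPoch ((q : ℂ) ^ (3 * b + 1 / 2)) q (2 * n)) /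
  qPoch q q (4 * n + 2)

/-- Summand of the parameter-free `q`-analogue of the `8n+1` series. -/
def termA₀ (q : ℂ) (n : ℕ) : ℂ :=
  q ^ (2 * n ^ 2) * (1 - q ^ (8 * n + 1)) * qPoch q (q ^ 2) (2 * n) * qPoch q (q ^ 2) n ^ 2 /
  (qPoch (q ^ 2) (q ^ 2) (2 * n) * qPoch (q ^ 6) (q ^ 6) n ^ 2)

/-- The polynomial factor of the parameter-free `q`-analogue of the `28n+3` series. -/
def polyB₀ (q : ℂ) (n : ℕ) : ℂ :=
    q ^ (2 * n + 1) + q ^ (4 * n + 1) + q ^ (4 * n + 2) + q ^ (6 * n + 2) + q ^ (6 * n + 3)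
      + q ^ (8 * n + 2) + q ^ (8 * n + 3) - q ^ (10 * n + 1) + q ^ (10 * n + 4)
      - q ^ (12 * n + 2) - q ^ (12 * n + 3) - q ^ (14 * n + 2) - q ^ (14 * n + 3)
      - q ^ (16 * n + 3) - q ^ (16 * n + 4) - q ^ (18 * n + 4) - q ^ (20 * n + 5) + 1

/-- Summand of the parameter-free `q`-analogue of the `28n+3` series. -/
def termB₀ (q : ℂ) (n : ℕ) : ℂ :=
  (-1) ^ n * q ^ (5 * n ^ 2) * polyB₀ q n *
    qPoch q (q ^ 2) n * qPoch (q ^ 3) (q ^ 6) n * qPoch q (q ^ 2) (2 * n) ^ 2 /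
  ((q ^ (2 * n + 1) + 1) * (q ^ (4 * n + 1) + 1) * (q ^ (4 * n + 2) + 1) *
    qPoch (q ^ 2) (q ^ 2) (4 * n) * qPoch (q ^ 6) (q ^ 6) n ^ 2)

/-- The common right-hand side of the two parameter-free `q`-analogues. -/
def rhs₀ (q : ℝ) : ℂ :=
  (((1 - q ^ 2) * √(q ^ 4 + q ^ 2 + 1) : ℝ) : ℂ) /
    (qGamma (q ^ 2) (1 / 2) * qGamma (q ^ 6) (1 / 2))

/-- Summand of the classical `8n+1` series. -/
def classicalA (n : ℕ) : ℝ :=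
  (1 / 9) ^ n * (poch (1 / 2) n * poch (1 / 4) n * poch (3 / 4) n / poch 1 n ^ 3) * (8 * n + 1)

/-- Summand of the classical `28n+3` series. -/
def classicalB (n : ℕ) : ℝ :=
  (-1 / 48) ^ n * (poch (1 / 2) n * poch (1 / 4) n * poch (3 / 4) n / poch 1 n ^ 3) * (28 * n + 3)

end

/-!
Write `a = q ^ (1/2 + 3b)` and `z = q ^ (3c)`. After clearing the denominators that depend on `z`,
the left-hand side becomes an entire function `S z` obeying the contiguous relation
`S z = (1 - a z) (1 - a z q) (1 - a z q²) S (z q³)`: the difference of the two sides telescopes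
termwise by an explicit certificate. Iterating, and using continuity at `0`, gives
`S z = (a z; q)_∞ S 0`. The value `S 0 = ∑ q ^ (n²) (a, q/a; q)_n / (q; q)_{2n}` is found by
expanding `(a, q/a; q)_n` through the finite Jacobi triple product and summing over `n` with
Cauchy's identity, as in the limiting case of Bailey's lemma: what remains is a theta series of
base `q³`, a product by the triple product identity. In the second formula each term of the series
at `z = 0` combines the terms `2n` and `2n + 1` of `S 0`.

The classical evaluations are the limits `q → 1⁻` of the two specializations, by Tannery's
theorem; the constant `π` enters through a `q`-analogue of Wallis' product for `Γ_{q²}(1/2)`.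
-/

open Asymptotics Metric Set

section qPochhammer

variable {q : ℂ}

theorem qPoch_zero (a q : ℂ) : qPoch a q 0 = 1 := by simp [qPoch]

theorem qPoch_succ (a q : ℂ) (n : ℕ) : qPoch a q (n + 1) = qPoch a q n * (1 - a * q ^ n) := by
  simp [qPoch, Finset.prod_range_succ]

theorem qPoch_add (a q : ℂ) (m n : ℕ) :
    qPoch a q (m + n) = qPoch a q m * qPoch (a * q ^ m) q n := by
  simp only [qPoch, Finset.prod_range_add]
  congr 1
  exact Finset.prod_congr rfl fun k _ => by ring

theorem qPoch_zero_left (q : ℂ) (n : ℕ) : qPoch 0 q n = 1 := by simp [qPoch]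

theorem qPochInf_zero_left (q : ℂ) : qPochInf 0 q = 1 := by simp [qPochInf]

theorem qPoch_eq_zero_iff (a q : ℂ) (n : ℕ) : qPoch a q n = 0 ↔ ∃ k < n, a * q ^ k = 1 := by
  simp only [qPoch, Finset.prod_eq_zero_iff, Finset.mem_range, sub_eq_zero, eq_comm (a := (1 : ℂ))]

theorem prod_range_qPoch_mul_pow (a q : ℂ) (m k : ℕ) :
    ∏ j ∈ Finset.range k, qPoch (a * (q ^ m) ^ j) q m = qPoch a q (m * k) := by
  induction k with
  | zero => simp [qPoch_zero]
  | succ k ih => rw [Finset.prod_range_succ, ih, Nat.mul_succ, qPoch_add, pow_mul]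

theorem norm_pow_three_lt_one (hq : ‖q‖ < 1) : ‖q ^ 3‖ < 1 := by
  rw [norm_pow]
  exact pow_lt_one₀ (norm_nonneg _) hq three_ne_zero

theorem summable_norm_mul_pow (hq : ‖q‖ < 1) (a : ℂ) : Summable fun k : ℕ => ‖-(a * q ^ k)‖ := by
  simp only [norm_neg, norm_mul, norm_pow]
  exact (summable_geometric_of_lt_one (norm_nonneg _) hq).mul_left _

theorem tendsto_qPoch (hq : ‖q‖ < 1) (a : ℂ) : Tendsto (qPoch a q) atTop (𝓝 (qPochInf a q)) := by
  have := multipliable_one_add_of_summable (summable_norm_mul_pow hq a)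
  simp only [← sub_eq_add_neg] at this
  exact this.hasProd.tendsto_prod_nat

theorem qPochInf_eq_qPoch_mul (hq : ‖q‖ < 1) (a : ℂ) (n : ℕ) :
    qPochInf a q = qPoch a q n * qPochInf (a * q ^ n) q := by
  refine tendsto_nhds_unique ((tendsto_add_atTop_iff_nat n).2 (tendsto_qPoch hq a)) ?_
  simp_rw [add_comm _ n, qPoch_add]
  exact (tendsto_qPoch hq _).const_mul _

theorem qPochInf_eq_one_sub_mul (hq : ‖q‖ < 1) (a : ℂ) :
    qPochInf a q = (1 - a) * qPochInf (a * q) q := by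
  rw [qPochInf_eq_qPoch_mul hq a 1]; simp [qPoch]

theorem qPochInf_ne_zero (hq : ‖q‖ < 1) {a : ℂ} (h : ∀ k : ℕ, a * q ^ k ≠ 1) :
    qPochInf a q ≠ 0 := by
  have := tprod_one_add_ne_zero_of_summable (f := fun k : ℕ => -(a * q ^ k))
    (fun k => by rw [← sub_eq_add_neg, sub_ne_zero]; exact (h k).symm) (summable_norm_mul_pow hq a)
  simpa [qPochInf, sub_eq_add_neg] using this

theorem mul_pow_ne_one_of_norm_lt (hq : ‖q‖ < 1) {a : ℂ} (ha : ‖a‖ < 1) (k : ℕ) :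
    a * q ^ k ≠ 1 := by
  intro h
  have hlt : ‖a * q ^ k‖ < 1 := by
    rw [norm_mul, norm_pow]
    exact mul_lt_one_of_nonneg_of_lt_one_left (norm_nonneg _) ha (pow_le_one₀ (norm_nonneg _) hq.le)
  simp [h] at hlt

theorem qPochInf_ne_zero_of_norm_lt (hq : ‖q‖ < 1) {a : ℂ} (ha : ‖a‖ < 1) : qPochInf a q ≠ 0 :=
  qPochInf_ne_zero hq (mul_pow_ne_one_of_norm_lt hq ha)

theorem qPoch_self_ne_zero (hq : ‖q‖ < 1) (n : ℕ) : qPoch q q n ≠ 0 := by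
  rw [Ne, qPoch_eq_zero_iff]
  rintro ⟨k, -, h⟩
  exact mul_pow_ne_one_of_norm_lt hq hq k h

theorem inv_qPoch_self_eq (hq : ‖q‖ < 1) (n : ℕ) :
    (qPoch q q n)⁻¹ = (qPochInf q q)⁻¹ * qPochInf (q * q ^ n) q := by
  rw [eq_inv_mul_iff_mul_eq₀ (qPochInf_ne_zero_of_norm_lt hq hq), qPochInf_eq_qPoch_mul hq q n,
    mul_right_comm, mul_inv_cancel₀ (qPoch_self_ne_zero hq _), one_mul]

@[fun_prop]
theorem continuous_qPoch (q : ℂ) (n : ℕ) : Continuous fun a => qPoch a q n := by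
  unfold qPoch
  fun_prop

@[fun_prop]
theorem continuous_qPochInf (hq : ‖q‖ < 1) : Continuous fun a => qPochInf a q := by
  refine continuous_iff_continuousAt.2 fun a => ?_
  have := tendsto_tprod_one_add_of_dominated_convergence (𝓕 := 𝓝 a)
    (f := fun b (k : ℕ) => -(b * q ^ k)) (g := fun k => -(a * q ^ k))
    (bound := fun k => (‖a‖ + 1) * ‖q‖ ^ k)
    ((summable_geometric_of_lt_one (norm_nonneg _) hq).mul_left _)
    (fun k => Continuous.tendsto (by fun_prop) a) ?_
  · simpa [ContinuousAt, qPochInf, sub_eq_add_neg] using this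
  · filter_upwards [continuous_norm.continuousAt.eventually_lt continuousAt_const (lt_add_one ‖a‖)]
      with b hb k
    rw [norm_neg, norm_mul, norm_pow]
    gcongr

end qPochhammer

section Bounds

variable {q : ℂ} {ι : Type*} {l : Filter ι}

theorem norm_qPoch_le (hq : ‖q‖ < 1) (a : ℂ) (n : ℕ) :
    ‖qPoch a q n‖ ≤ Real.exp (‖a‖ * (1 - ‖q‖)⁻¹) := by
  have hgeom := summable_geometric_of_lt_one (norm_nonneg q) hq
  calc ‖qPoch a q n‖ ≤ ∏ k ∈ Finset.range n, Real.exp (‖a‖ * ‖q‖ ^ k) := by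
        refine (Finset.norm_prod_le _ _).trans
          (Finset.prod_le_prod (fun _ _ => norm_nonneg _) fun k _ => ?_)
        have htri : ‖1 - a * q ^ k‖ ≤ 1 + ‖a‖ * ‖q‖ ^ k := by
          simpa [norm_mul, norm_pow] using norm_sub_le (1 : ℂ) (a * q ^ k)
        linarith [Real.add_one_le_exp (‖a‖ * ‖q‖ ^ k)]
    _ = Real.exp (‖a‖ * ∑ k ∈ Finset.range n, ‖q‖ ^ k) := by rw [← Real.exp_sum, Finset.mul_sum]
    _ ≤ Real.exp (‖a‖ * (1 - ‖q‖)⁻¹) := by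
        rw [← tsum_geometric_of_lt_one (norm_nonneg _) hq]
        gcongr
        exact hgeom.sum_le_tsum _ fun _ _ => by positivity

theorem norm_qPochInf_le (hq : ‖q‖ < 1) (a : ℂ) :
    ‖qPochInf a q‖ ≤ Real.exp (‖a‖ * (1 - ‖q‖)⁻¹) :=
  le_of_tendsto (tendsto_qPoch hq a).norm (Eventually.of_forall fun n => norm_qPoch_le hq a n)

theorem isBigO_one_of_norm_le_exp (hq : ‖q‖ < 1) {f g : ι → ℂ}
    (hf : f =O[l] fun _ => (1 : ℝ)) (hg : ∀ i, ‖g i‖ ≤ Real.exp (‖f i‖ * (1 - ‖q‖)⁻¹)) :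
    g =O[l] fun _ => (1 : ℝ) := by
  obtain ⟨R, hR⟩ := hf.bound
  refine IsBigO.of_bound (Real.exp (R * (1 - ‖q‖)⁻¹)) ?_
  filter_upwards [hR] with i hi
  simp only [norm_one, mul_one] at hi ⊢
  have : 0 ≤ (1 - ‖q‖)⁻¹ := inv_nonneg.2 (sub_nonneg.2 hq.le)
  exact (hg i).trans (by gcongr)

theorem isBigO_qPoch (hq : ‖q‖ < 1) {f : ι → ℂ} (hf : f =O[l] fun _ => (1 : ℝ)) (m : ι → ℕ) :
    (fun i => qPoch (f i) q (m i)) =O[l] fun _ => (1 : ℝ) :=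
  isBigO_one_of_norm_le_exp hq hf fun i => norm_qPoch_le hq (f i) (m i)

theorem isBigO_qPochInf (hq : ‖q‖ < 1) {f : ι → ℂ} (hf : f =O[l] fun _ => (1 : ℝ)) :
    (fun i => qPochInf (f i) q) =O[l] fun _ => (1 : ℝ) :=
  isBigO_one_of_norm_le_exp hq hf fun i => norm_qPochInf_le hq (f i)

theorem isBigO_pow_one (hq : ‖q‖ < 1) (m : ι → ℕ) :
    (fun i => q ^ m i) =O[l] fun _ => (1 : ℝ) :=
  IsBigO.of_bound 1 (Eventually.of_forall fun i => by
    simpa using pow_le_one₀ (norm_nonneg q) hq.le)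

theorem isBigO_one_mul {f g : ι → ℂ} (hf : f =O[l] fun _ => (1 : ℝ))
    (hg : g =O[l] fun _ => (1 : ℝ)) :
    (fun i => f i * g i) =O[l] fun _ => (1 : ℝ) := by simpa using hf.mul hg

theorem isBigO_inv_qPoch_self (hq : ‖q‖ < 1) (m : ι → ℕ) :
    (fun i => (qPoch q q (m i))⁻¹) =O[l] fun _ => (1 : ℝ) := by
  simp_rw [inv_qPoch_self_eq hq]
  refine (isBigO_qPochInf hq ?_).const_mul_left _
  simpa using (isBigO_pow_one hq m).const_mul_left q

end Bounds

section Contiguous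

theorem tsum_eq_tsum_of_sub_eq_sub {E : Type*} [AddCommGroup E] [TopologicalSpace E]
    [IsTopologicalAddGroup E] [T2Space E] {f g u : ℕ → E} (hf : Summable f) (hg : Summable g)
    (hu : Tendsto u atTop (𝓝 0)) (hu0 : u 0 = 0) (h : ∀ n, f n - g n = u (n + 1) - u n) :
    ∑' n, f n = ∑' n, g n := by
  rw [← sub_eq_zero, ← hf.tsum_sub hg]
  refine tendsto_nhds_unique (hf.sub hg).hasSum.tendsto_sum_nat ?_
  simpa only [h, Finset.sum_range_sub, hu0, sub_zero] using hu

variable {𝕜 : Type*} [NormedField 𝕜] [CompleteSpace 𝕜]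

theorem hasSum_of_contiguous {p : 𝕜} (hp : ‖p‖ < 1) {F G : 𝕜 → ℕ → 𝕜} {c : 𝕜 → 𝕜} {L z : 𝕜}
    {b : ℕ → ℝ} (hb : Summable b)
    (hFb : (fun x : 𝕜 × ℕ => F x.1 x.2) =O[𝓟 (closedBall 0 ‖z‖ ×ˢ univ)] fun x => b x.2)
    (hGb : (fun x : 𝕜 × ℕ => G x.1 x.2) =O[𝓟 (closedBall 0 ‖z‖ ×ˢ univ)] fun x => b x.2)
    (hcont : ∀ n, ContinuousAt (fun w => F w n) 0)
    (htel : ∀ w n, F w n - c w * F (w * p) n = G w (n + 1) - G w n) (hG0 : ∀ w, G w 0 = 0)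
    (hc : Tendsto (fun k => ∏ j ∈ Finset.range k, c (z * p ^ j)) atTop (𝓝 L)) :
    HasSum (F z) (L * ∑' n, F 0 n) := by
  obtain ⟨K, hK⟩ := isBigO_principal.1 hFb
  obtain ⟨K', hK'⟩ := isBigO_principal.1 hGb
  have hball : ∀ k, z * p ^ k ∈ closedBall (0 : 𝕜) ‖z‖ := fun k => by
    rw [mem_closedBall_zero_iff, norm_mul, norm_pow]
    exact mul_le_of_le_one_right (norm_nonneg _) (pow_le_one₀ (norm_nonneg _) hp.le)
  have hFk : ∀ k n, ‖F (z * p ^ k) n‖ ≤ K * ‖b n‖ := fun k n => hK (_, n) ⟨hball k, mem_univ n⟩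
  have hsum : ∀ k, Summable (F (z * p ^ k)) := fun k =>
    (hb.norm.mul_left K).of_norm_bounded (hFk k)
  have hstep : ∀ k, ∑' n, F (z * p ^ k) n = c (z * p ^ k) * ∑' n, F (z * p ^ (k + 1)) n := by
    intro k
    rw [← tsum_mul_left]
    refine tsum_eq_tsum_of_sub_eq_sub (hsum k) ((hsum (k + 1)).mul_left _)
      (squeeze_zero_norm (fun n => hK' (_, n) ⟨hball k, mem_univ n⟩) ?_) (hG0 _) fun n => ?_
    · simpa using hb.norm.tendsto_atTop_zero.const_mul K'
    · rw [pow_succ, ← mul_assoc, htel]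
  have hiter : ∀ k, ∑' n, F z n =
      (∏ j ∈ Finset.range k, c (z * p ^ j)) * ∑' n, F (z * p ^ k) n := by
    intro k
    induction k with
    | zero => simp
    | succ k ih => rw [ih, hstep, Finset.prod_range_succ, mul_assoc]
  have hzero : Tendsto (fun k => z * p ^ k) atTop (𝓝 0) := by
    simpa using (tendsto_pow_atTop_nhds_zero_of_norm_lt_one hp).const_mul z
  have hlim : Tendsto (fun k => ∑' n, F (z * p ^ k) n) atTop (𝓝 (∑' n, F 0 n)) :=
    tendsto_tsum_of_dominated_convergence (hb.norm.mul_left K)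
      (fun n => (hcont n).tendsto.comp hzero) (Eventually.of_forall hFk)
  rw [← tendsto_nhds_unique (tendsto_const_nhds.congr hiter) (hc.mul hlim)]
  simpa using (hsum 0).hasSum

end Contiguous

section InvQPoch

variable {q : ℂ}

/-- The reciprocal `1 / (q; q)_m`, extended by `0` to negative `m` so that the recursion
`invQPoch_sub_one` holds for all integers and sums over `ℤ` need no range restrictions. -/
noncomputable def invQPoch (q : ℂ) (m : ℤ) : ℂ :=
  if 0 ≤ m then (qPoch q q m.toNat)⁻¹ else 0

theorem invQPoch_natCast (q : ℂ) (n : ℕ) : invQPoch q n = (qPoch q q n)⁻¹ := by simp [invQPoch]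

theorem invQPoch_of_neg (q : ℂ) {m : ℤ} (hm : m < 0) : invQPoch q m = 0 :=
  if_neg (not_le.2 hm)

theorem invQPoch_sub_one (hq : ‖q‖ < 1) (m : ℤ) :
    invQPoch q (m - 1) = (1 - q ^ m) * invQPoch q m := by
  obtain hm | rfl | hm := lt_trichotomy m 0
  · rw [invQPoch_of_neg q hm, invQPoch_of_neg q (by lia), mul_zero]
  · simp [invQPoch_of_neg]
  · obtain ⟨n, rfl⟩ : ∃ n : ℕ, m = n + 1 := ⟨(m - 1).toNat, by lia⟩
    have hne := qPoch_self_ne_zero hq (n + 1)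
    rw [add_sub_cancel_right, ← Nat.cast_succ, invQPoch_natCast, invQPoch_natCast, zpow_natCast,
      Nat.succ_eq_add_one, eq_mul_inv_iff_mul_eq₀ hne, qPoch_succ, ← pow_succ',
      inv_mul_cancel_left₀ (qPoch_self_ne_zero hq n)]

theorem exists_norm_invQPoch_le (hq : ‖q‖ < 1) : ∃ K, ∀ m, ‖invQPoch q m‖ ≤ K := by
  obtain ⟨K, hK⟩ := isBigO_top.1 (isBigO_inv_qPoch_self (l := ⊤) hq id)
  refine ⟨max K 0, fun m => ?_⟩
  rw [invQPoch]
  split_ifs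
  · simpa using Or.inl (hK m.toNat)
  · simp

theorem tendsto_invQPoch (hq : ‖q‖ < 1) : Tendsto (invQPoch q) atTop (𝓝 (qPochInf q q)⁻¹) := by
  have htoNat : Tendsto Int.toNat atTop atTop :=
    Filter.tendsto_atTop.2 fun n => (eventually_ge_atTop (n : ℤ)).mono fun m hm => by lia
  refine (((tendsto_qPoch hq q).comp htoNat).inv₀ (qPochInf_ne_zero_of_norm_lt hq hq)).congr' ?_
  filter_upwards [eventually_ge_atTop 0] with m hm using (if_pos hm).symm

end InvQPoch

section JacobiTripleProduct

variable {x q : ℂ}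

/-- The summand `(-x)^r q^{r(r-1)/2}` of the Jacobi theta series. -/
noncomputable def thetaTerm (x q : ℂ) (r : ℤ) : ℂ :=
  (-x) ^ r * q ^ (r * (r - 1) / 2)

theorem mul_sub_one_ediv_two_mul_two (r : ℤ) : r * (r - 1) / 2 * 2 = r * (r - 1) :=
  Int.ediv_mul_cancel (Int.even_mul_pred_self r).two_dvd

theorem thetaTerm_add_one (hx : x ≠ 0) (hq : q ≠ 0) (r : ℤ) :
    thetaTerm x q (r + 1) = -x * q ^ r * thetaTerm x q r := by
  have hexp : (r + 1) * (r + 1 - 1) / 2 = r + r * (r - 1) / 2 := by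
    linarith [mul_sub_one_ediv_two_mul_two r, mul_sub_one_ediv_two_mul_two (r + 1)]
  rw [thetaTerm, thetaTerm, hexp, zpow_add₀ hq, zpow_add_one₀ (neg_ne_zero.2 hx)]
  ring

theorem thetaTerm_neg (hx : x ≠ 0) (hq : q ≠ 0) (r : ℤ) :
    thetaTerm x q (-r) = thetaTerm (q / x) q r := by
  have hexp : -r * (-r - 1) / 2 = r + r * (r - 1) / 2 := by
    linarith [mul_sub_one_ediv_two_mul_two r, mul_sub_one_ediv_two_mul_two (-r)]
  rw [thetaTerm, thetaTerm, hexp, zpow_add₀ hq, ← mul_assoc, zpow_neg, ← inv_zpow, ← mul_zpow]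
  congr 2
  field_simp

theorem thetaTerm_natCast (x q : ℂ) (n : ℕ) : thetaTerm x q n = (-x) ^ n * q ^ n.choose 2 := by
  have hexp : (n : ℤ) * (n - 1) / 2 = n.choose 2 := by
    have := Nat.cast_choose_two ℚ n
    have := mul_sub_one_ediv_two_mul_two n
    qify at *
    linarith
  rw [thetaTerm, hexp, zpow_natCast, zpow_natCast]

theorem summable_pow_mul_pow_choose_two {ρ : ℝ} (hρ : |ρ| < 1) (R : ℝ) :
    Summable fun n : ℕ => R ^ n * ρ ^ n.choose 2 := by
  refine summable_of_ratio_norm_eventually_le (r := 1 / 2) (by norm_num) ?_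
  have hlim : Tendsto (fun n : ℕ => ‖R * ρ ^ n‖) atTop (𝓝 0) := by
    simpa using ((tendsto_pow_atTop_nhds_zero_of_abs_lt_one hρ).const_mul R).norm
  filter_upwards [hlim.eventually_le_const (by norm_num : (0 : ℝ) < 1 / 2)] with n hn
  have hrec : R ^ (n + 1) * ρ ^ (n + 1).choose 2 = R * ρ ^ n * (R ^ n * ρ ^ n.choose 2) := by
    rw [Nat.choose_succ_succ' n 1, Nat.choose_one_right]
    ring
  rw [hrec, norm_mul]
  gcongr

theorem summable_norm_thetaTerm (hx : x ≠ 0) (hq : q ≠ 0) (hq1 : ‖q‖ < 1) :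
    Summable fun r => ‖thetaTerm x q r‖ := by
  have hnat : ∀ y : ℂ, Summable fun n : ℕ => ‖thetaTerm y q n‖ := fun y => by
    simpa [thetaTerm_natCast] using
      summable_pow_mul_pow_choose_two (by simpa using hq1 : |‖q‖| < 1) ‖y‖
  refine Summable.of_nat_of_neg (hnat x) ?_
  simpa only [thetaTerm_neg hx hq] using hnat (q / x)

theorem invQPoch_mul_invQPoch_succ (hq : q ≠ 0) (hq1 : ‖q‖ < 1) (n : ℕ) (r : ℤ) :
    (1 - q ^ (2 * n + 1)) * (1 - q ^ (2 * n + 2)) *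
        (invQPoch q (n + 1 - r) * invQPoch q (n + 1 + r)) =
      (1 + q ^ (2 * n + 1)) * (invQPoch q (n - r) * invQPoch q (n + r)) +
        q ^ (n + 1 - r) * (invQPoch q (n - (r - 1)) * invQPoch q (n + (r - 1))) +
        q ^ (n + 1 + r) * (invQPoch q (n - (r + 1)) * invQPoch q (n + (r + 1))) := by
  have hsub_two (s : ℤ) :
      invQPoch q (s - 1 - 1) = (1 - q ^ s / q) * ((1 - q ^ s) * invQPoch q s) := by
    rw [invQPoch_sub_one hq1, invQPoch_sub_one hq1, zpow_sub_one₀ hq, ← div_eq_mul_inv]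
  have hprod : q ^ (2 * n + 2) = q ^ (n + 1 - r) * q ^ (n + 1 + r) := by
    rw [← zpow_add₀ hq, ← zpow_natCast]
    congr 1
    push_cast
    ring
  have hprod' : q ^ (2 * n + 1) = q ^ (n + 1 - r) * q ^ (n + 1 + r) / q := by
    rw [← hprod, pow_succ q (2 * n + 1), mul_div_cancel_right₀ _ hq]
  rw [show (n : ℤ) - (r - 1) = n + 1 - r by ring, show (n : ℤ) + (r + 1) = n + 1 + r by ring,
    show (n : ℤ) - (r + 1) = n + 1 - r - 1 - 1 by ring, hsub_two,
    show (n : ℤ) + (r - 1) = n + 1 + r - 1 - 1 by ring, hsub_two,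
    show (n : ℤ) - r = n + 1 - r - 1 by ring, invQPoch_sub_one hq1,
    show (n : ℤ) + r = n + 1 + r - 1 by ring, invQPoch_sub_one hq1, hprod, hprod']
  field_simp
  ring

theorem invQPoch_mul_thetaTerm_succ (hx : x ≠ 0) (hq : q ≠ 0) (hq1 : ‖q‖ < 1) (n : ℕ) (r : ℤ) :
    (1 - q ^ (2 * n + 1)) * (1 - q ^ (2 * n + 2)) *
        (invQPoch q (n + 1 - r) * invQPoch q (n + 1 + r) * thetaTerm x q r) =
      (1 + q ^ (2 * n + 1)) * (invQPoch q (n - r) * invQPoch q (n + r) * thetaTerm x q r) +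
        -x * q ^ n *
          (invQPoch q (n - (r - 1)) * invQPoch q (n + (r - 1)) * thetaTerm x q (r - 1)) +
        -x⁻¹ * q ^ (n + 1) *
          (invQPoch q (n - (r + 1)) * invQPoch q (n + (r + 1)) * thetaTerm x q (r + 1)) := by
  have hsucc := thetaTerm_add_one hx hq r
  have hpred := thetaTerm_add_one hx hq (r - 1)
  have hpow : q ^ (n + 1 - r) * q ^ (r - 1) = q ^ n := by
    rw [← zpow_add₀ hq, ← zpow_natCast]
    congr 1
    ring
  have hpow' : q ^ (n + 1 + r) = q ^ (n + 1) * q ^ r := by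
    rw [zpow_add₀ hq, ← Nat.cast_succ, zpow_natCast]
  rw [sub_add_cancel] at hpred
  rw [← mul_assoc, invQPoch_mul_invQPoch_succ hq hq1, hsucc, ← hpow, hpow']
  generalize invQPoch q (n - (r - 1)) * invQPoch q (n + (r - 1)) = b
  field_simp
  linear_combination q ^ (n + 1 - r) * b * hpred

theorem hasSum_jacobiTripleProduct_finite (hx : x ≠ 0) (hq : q ≠ 0) (hq1 : ‖q‖ < 1) (n : ℕ) :
    HasSum (fun r : ℤ => invQPoch q (n - r) * invQPoch q (n + r) * thetaTerm x q r)
      (qPoch x q n * qPoch (q / x) q n / qPoch q q (2 * n)) := by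
  induction n with
  | zero =>
    have hzero (r : ℤ) (hr : r ≠ 0) : invQPoch q ((0 : ℕ) - r) * invQPoch q ((0 : ℕ) + r) *
        thetaTerm x q r = 0 := by
      obtain hr | hr := hr.lt_or_gt
      · rw [invQPoch_of_neg q (m := (0 : ℕ) + r) (by lia), mul_zero, zero_mul]
      · rw [invQPoch_of_neg q (m := (0 : ℕ) - r) (by lia), zero_mul, zero_mul]
    simpa [invQPoch, thetaTerm, qPoch_zero] using hasSum_single 0 hzero
  | succ n ih =>
    have hfactor : qPoch q q (2 * (n + 1)) =
        qPoch q q (2 * n) * ((1 - q ^ (2 * n + 1)) * (1 - q ^ (2 * n + 2))) := by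
      rw [mul_add, mul_one, qPoch_succ, qPoch_succ, ← pow_succ', ← pow_succ', mul_assoc]
    have hne : (1 - q ^ (2 * n + 1)) * (1 - q ^ (2 * n + 2)) ≠ 0 :=
      right_ne_zero_of_mul (hfactor ▸ qPoch_self_ne_zero hq1 (2 * (n + 1)))
    have hval : (1 - q ^ (2 * n + 1)) * (1 - q ^ (2 * n + 2)) *
        (qPoch x q (n + 1) * qPoch (q / x) q (n + 1) / qPoch q q (2 * (n + 1))) =
        (1 + q ^ (2 * n + 1) + -x * q ^ n + -x⁻¹ * q ^ (n + 1)) *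
          (qPoch x q n * qPoch (q / x) q n / qPoch q q (2 * n)) := by
      rw [hfactor, mul_comm (qPoch q q (2 * n)), ← mul_div_assoc, mul_div_mul_left _ _ hne,
        qPoch_succ, qPoch_succ]
      field_simp
      ring
    have hup := ((Equiv.subRight (1 : ℤ)).hasSum_iff.2 ih).mul_left (-x * q ^ n)
    have hdown := ((Equiv.addRight (1 : ℤ)).hasSum_iff.2 ih).mul_left (-x⁻¹ * q ^ (n + 1))
    rw [← hasSum_mul_left_iff hne, Nat.cast_succ, funext (invQPoch_mul_thetaTerm_succ hx hq hq1 n),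
      hval, add_mul, add_mul]
    exact ((ih.mul_left _).add hup).add hdown

theorem tsum_thetaTerm (hx : x ≠ 0) (hq : q ≠ 0) (hq1 : ‖q‖ < 1) :
    ∑' r, thetaTerm x q r = qPochInf x q * qPochInf (q / x) q * qPochInf q q := by
  obtain ⟨K, hK⟩ := exists_norm_invQPoch_le hq1
  have hne := qPochInf_ne_zero_of_norm_lt hq1 hq1
  have hcoeff (r : ℤ) : Tendsto (fun n : ℕ => invQPoch q (n - r) * invQPoch q (n + r) *
      thetaTerm x q r) atTop (𝓝 ((qPochInf q q)⁻¹ * (qPochInf q q)⁻¹ * thetaTerm x q r)) := by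
    have hcast := tendsto_natCast_atTop_atTop (R := ℤ)
    exact (((tendsto_invQPoch hq1).comp (tendsto_atTop_add_const_right _ (-r) hcast)).mul
      ((tendsto_invQPoch hq1).comp (tendsto_atTop_add_const_right _ r hcast))).mul_const _
  have hlim := tendsto_tsum_of_dominated_convergence (𝓕 := atTop)
    ((summable_norm_thetaTerm hx hq hq1).mul_left (K * K)) hcoeff
    (Eventually.of_forall fun n r => by
      rw [norm_mul, norm_mul]
      gcongr
      exacts [(norm_nonneg _).trans (hK 0), hK _, hK _])
  simp_rw [(hasSum_jacobiTripleProduct_finite hx hq hq1 _).tsum_eq, tsum_mul_left] at hlim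
  have hprod := ((tendsto_qPoch hq1 x).mul (tendsto_qPoch hq1 (q / x))).div
    ((tendsto_qPoch hq1 q).comp (tendsto_id.const_mul_atTop' two_pos)) hne
  have heq := tendsto_nhds_unique hlim hprod
  field_simp at heq
  linear_combination heq

end JacobiTripleProduct

section BaileyLimit

variable {a q : ℂ}

theorem summable_pow_mul_pow_sq {ρ : ℝ} (hρ : |ρ| < 1) (R : ℝ) :
    Summable fun n : ℕ => R ^ n * ρ ^ n ^ 2 := by
  have hρ2 : |ρ ^ 2| < 1 := by rw [abs_pow]; exact pow_lt_one₀ (abs_nonneg _) hρ two_ne_zero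
  refine (summable_pow_mul_pow_choose_two hρ2 (R * ρ)).congr fun n => ?_
  rw [mul_pow, mul_assoc, ← pow_mul, ← pow_add, Nat.choose_two_right,
    Nat.mul_div_cancel' (Nat.even_mul_pred_self n).two_dvd, sq, Nat.mul_sub, mul_one,
    Nat.add_sub_cancel' (Nat.le_mul_self n)]

theorem isBigO_mul_pow_closedBall (hq1 : ‖q‖ < 1) (R : ℝ) (m : ℕ → ℕ) :
    (fun x : ℂ × ℕ => x.1 * q ^ m x.2) =O[𝓟 (closedBall 0 R ×ˢ univ)] fun _ => (1 : ℝ) := by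
  refine isBigO_one_mul (isBigO_principal.2 ⟨R, ?_⟩) (isBigO_pow_one hq1 _)
  rintro x ⟨hx, -⟩
  simpa using hx

theorem hasSum_cauchy (hq1 : ‖q‖ < 1) (z : ℂ) :
    HasSum (fun m => q ^ m ^ 2 * z ^ m * (qPochInf (z * q ^ (m + 1)) q * (qPoch q q m)⁻¹)) 1 := by
  let F (w : ℂ) (m : ℕ) : ℂ := q ^ m ^ 2 * w ^ m *
    (qPochInf (w * q ^ (m + 1)) q * (qPoch q q m)⁻¹)
  let G (w : ℂ) (m : ℕ) : ℂ := -(F w m * (1 - q ^ m))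
  have htel (w : ℂ) (m : ℕ) : F w m - 1 * F (w * q) m = G w (m + 1) - G w m := by
    have hinf := qPochInf_eq_one_sub_mul hq1 (w * q ^ (m + 1))
    have hfin : (qPoch q q (m + 1))⁻¹ * (1 - q ^ (m + 1)) = (qPoch q q m)⁻¹ := by
      rw [inv_mul_eq_iff_eq_mul₀ (qPoch_self_ne_zero hq1 (m + 1)), qPoch_succ, ← pow_succ',
        mul_right_comm, mul_inv_cancel₀ (qPoch_self_ne_zero hq1 m), one_mul]
    simp only [F, G, hinf, ← hfin]
    ring_nf
  have hF : (fun x : ℂ × ℕ => F x.1 x.2) =O[𝓟 (closedBall 0 ‖z‖ ×ˢ univ)]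
      fun x => ‖z‖ ^ x.2 * ‖q‖ ^ x.2 ^ 2 := by
    have hpow : (fun x : ℂ × ℕ => q ^ x.2 ^ 2 * x.1 ^ x.2) =O[𝓟 (closedBall 0 ‖z‖ ×ˢ univ)]
        fun x => ‖z‖ ^ x.2 * ‖q‖ ^ x.2 ^ 2 := by
      refine isBigO_principal.2 ⟨1, ?_⟩
      rintro x ⟨hx, -⟩
      rw [mem_closedBall_zero_iff] at hx
      simp only [norm_mul, norm_pow, norm_norm, one_mul, mul_comm (‖q‖ ^ _)]
      gcongr
    simpa using hpow.mul (isBigO_one_mul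
      (isBigO_qPochInf hq1 (isBigO_mul_pow_closedBall hq1 ‖z‖ (· + 1)))
      (isBigO_inv_qPoch_self hq1 Prod.snd))
  have hG : (fun x : ℂ × ℕ => G x.1 x.2) =O[𝓟 (closedBall 0 ‖z‖ ×ˢ univ)]
      fun x => ‖z‖ ^ x.2 * ‖q‖ ^ x.2 ^ 2 := by
    simpa only [G, mul_one] using (hF.mul ((isBigO_const_one ℝ (1 : ℂ) _).sub
      (isBigO_pow_one hq1 Prod.snd))).neg_left
  have hcont (n : ℕ) : ContinuousAt (fun w => F w n) 0 := by
    have := continuous_qPochInf hq1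
    exact Continuous.continuousAt (by fun_prop)
  have h0 : ∑' n, F 0 n = 1 := by
    rw [tsum_eq_single 0 fun n hn => by simp [F, hn]]
    simp [F, qPochInf_zero_left, qPoch_zero]
  simpa [h0] using hasSum_of_contiguous (c := fun _ => 1) hq1
    (summable_pow_mul_pow_sq (by simpa using hq1) ‖z‖) hF hG hcont htel (by simp [G])
    (by simp)

theorem hasSum_pow_sq_mul_invQPoch_mul_invQPoch (hq1 : ‖q‖ < 1) (r : ℤ) :
    HasSum (fun n : ℕ => q ^ n ^ 2 * (invQPoch q (n - r) * invQPoch q (n + r)))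
      (q ^ (r ^ 2) / qPochInf q q) := by
  wlog hr : 0 ≤ r generalizing r
  · simpa [mul_comm, ← sub_eq_add_neg] using this (-r) (by lia)
  lift r to ℕ using hr with s
  have hterm (m : ℕ) : q ^ (m + s) ^ 2 *
      (invQPoch q ((m + s : ℕ) - (s : ℤ)) * invQPoch q ((m + s : ℕ) + (s : ℤ))) =
      q ^ s ^ 2 / qPochInf q q * (q ^ m ^ 2 * (q ^ (2 * s)) ^ m *
        (qPochInf (q ^ (2 * s) * q ^ (m + 1)) q * (qPoch q q m)⁻¹)) := by
    rw [← Nat.cast_add, Nat.cast_add m, add_sub_cancel_right, invQPoch_natCast, invQPoch_natCast,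
      inv_qPoch_self_eq hq1 (m + s + s)]
    ring_nf
  have hsum : HasSum (fun m : ℕ => q ^ (m + s) ^ 2 *
      (invQPoch q ((m + s : ℕ) - (s : ℤ)) * invQPoch q ((m + s : ℕ) + (s : ℤ))))
      (q ^ s ^ 2 / qPochInf q q) := by
    simpa only [hterm, mul_one] using (hasSum_cauchy hq1 (q ^ (2 * s))).mul_left _
  have hlow (n : ℕ) (hn : n ∉ range fun m => m + s) :
      q ^ n ^ 2 * (invQPoch q (n - s) * invQPoch q (n + s)) = 0 := by
    have : n < s := not_le.1 fun h : s ≤ n => hn ⟨n - s, Nat.sub_add_cancel h⟩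
    rw [invQPoch_of_neg q (m := n - s) (by lia), zero_mul, mul_zero]
  exact_mod_cast ((add_left_injective s).hasSum_iff hlow).1 hsum

theorem thetaTerm_mul_pow_three (hq : q ≠ 0) (r : ℤ) :
    thetaTerm (a * q) (q ^ 3) r = q ^ r ^ 2 * thetaTerm a q r := by
  have hexp : r ^ 2 + r * (r - 1) / 2 = r + 3 * (r * (r - 1) / 2) := by
    linarith [mul_sub_one_ediv_two_mul_two r]
  have hq3 : (q ^ 3) ^ (r * (r - 1) / 2) = q ^ (3 * (r * (r - 1) / 2)) := by
    rw [zpow_mul, zpow_ofNat]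
  rw [thetaTerm, thetaTerm, mul_left_comm, ← zpow_add₀ hq, hexp, zpow_add₀ hq, hq3, ← neg_mul,
    mul_zpow, mul_assoc]

/-- The summand of the series obtained by letting `z → 0` in the contiguous families; its
coefficients `1 / (q; q)_{2n}` are those of a limiting case of Bailey's lemma. -/
noncomputable def baileyTerm (q a : ℂ) (n : ℕ) : ℂ :=
  q ^ n ^ 2 * (qPoch a q n * qPoch (q / a) q n) * (qPoch q q (2 * n))⁻¹

theorem hasSum_baileyTerm (ha : a ≠ 0) (hq : q ≠ 0) (hq1 : ‖q‖ < 1) :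
    HasSum (baileyTerm q a) (qPochInf (a * q) (q ^ 3) * qPochInf (q ^ 2 / a) (q ^ 3) *
      qPochInf (q ^ 3) (q ^ 3) / qPochInf q q) := by
  obtain ⟨K, hK⟩ := exists_norm_invQPoch_le hq1
  let t (p : ℕ × ℤ) : ℂ :=
    q ^ p.1 ^ 2 * (invQPoch q (p.1 - p.2) * invQPoch q (p.1 + p.2)) * thetaTerm a q p.2
  have hsum : Summable t := by
    have hq2 : Summable fun n : ℕ => ‖q ^ n ^ 2‖ := by
      simpa using summable_pow_mul_pow_sq (by simpa using hq1 : |‖q‖| < 1) 1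
    refine ((hq2.mul_of_nonneg (summable_norm_thetaTerm ha hq hq1) (fun _ => norm_nonneg _)
      fun _ => norm_nonneg _).mul_left (K * K)).of_norm_bounded fun p => ?_
    calc ‖t p‖ = ‖invQPoch q (p.1 - p.2)‖ * ‖invQPoch q (p.1 + p.2)‖ *
          (‖q ^ p.1 ^ 2‖ * ‖thetaTerm a q p.2‖) := by
            simp only [t, norm_mul]
            ring
      _ ≤ K * K * (‖q ^ p.1 ^ 2‖ * ‖thetaTerm a q p.2‖) := by
            gcongr
            exacts [(norm_nonneg _).trans (hK 0), hK _, hK _]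
  have hrow (n : ℕ) : HasSum (fun r => t (n, r)) (baileyTerm q a n) := by
    simpa only [t, baileyTerm, mul_assoc, div_eq_mul_inv] using
      (hasSum_jacobiTripleProduct_finite ha hq hq1 n).mul_left (q ^ n ^ 2)
  have hcol (r : ℤ) : HasSum (fun n => t (n, r)) (thetaTerm (a * q) (q ^ 3) r / qPochInf q q) := by
    rw [thetaTerm_mul_pow_three hq, mul_div_right_comm]
    simpa only [t] using (hasSum_pow_sq_mul_invQPoch_mul_invQPoch hq1 r).mul_right
      (thetaTerm a q r)
  have hcols : HasSum (fun r => thetaTerm (a * q) (q ^ 3) r / qPochInf q q) (∑' p, t p) :=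
    ((Equiv.prodComm ℤ ℕ).hasSum_iff.2 hsum.hasSum).prod_fiberwise hcol
  have hquot : q ^ 3 / (a * q) = q ^ 2 / a := by field_simp
  rw [← hquot, ← tsum_thetaTerm (mul_ne_zero ha hq) (pow_ne_zero 3 hq)
    (norm_pow_three_lt_one hq1), ← tsum_div_const, hcols.tsum_eq]
  exact hsum.hasSum.prod_fiberwise hrow

end BaileyLimit

section ContiguousFamilies

variable {a q : ℂ}

theorem qPoch_three_mul_qPoch (x q : ℂ) (n : ℕ) :
    qPoch x q 3 * qPoch (x * q ^ 3) q n =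
      qPoch x q n * ((1 - x * q ^ n) * (1 - x * q ^ (n + 1)) * (1 - x * q ^ (n + 2))) := by
  rw [← qPoch_add, add_comm, qPoch_succ, qPoch_succ, qPoch_succ]
  ring

theorem baileyTerm_succ (ha : a ≠ 0) (hq1 : ‖q‖ < 1) (n : ℕ) :
    a * baileyTerm q a (n + 1) * ((1 - q ^ (2 * n + 1)) * (1 - q ^ (2 * n + 2))) =
      baileyTerm q a n * (q ^ (2 * n + 1) * (1 - a * q ^ n) * (a - q ^ (n + 1))) := by
  have hsucc : qPoch q q (2 * (n + 1)) =
      qPoch q q (2 * n) * ((1 - q ^ (2 * n + 1)) * (1 - q ^ (2 * n + 2))) := by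
    rw [mul_add, mul_one, qPoch_succ, qPoch_succ]
    ring
  have hne := right_ne_zero_of_mul (hsucc ▸ qPoch_self_ne_zero hq1 (2 * (n + 1)))
  rw [baileyTerm, baileyTerm, hsucc, mul_inv, qPoch_succ, qPoch_succ]
  generalize (1 - q ^ (2 * n + 1)) * (1 - q ^ (2 * n + 2)) = W at hne
  field_simp
  ring

/-- The product `(z q^(3n+3), a² z q^(3n+2); q³)_∞`. Multiplying the summands of the two-variable
series by it clears their denominators that depend on `z`. -/
noncomputable def clearingProduct (q a z : ℂ) (n : ℕ) : ℂ :=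
  qPochInf (z * q ^ (3 * n + 3)) (q ^ 3) * qPochInf (a ^ 2 * z * q ^ (3 * n + 2)) (q ^ 3)

theorem clearingProduct_eq (hq1 : ‖q‖ < 1) (a z : ℂ) (n : ℕ) :
    clearingProduct q a z n = (1 - z * q ^ (3 * n + 3)) * (1 - a ^ 2 * z * q ^ (3 * n + 2)) *
      clearingProduct q a z (n + 1) := by
  have hq3 := norm_pow_three_lt_one hq1
  rw [clearingProduct, qPochInf_eq_one_sub_mul hq3, qPochInf_eq_one_sub_mul hq3 (a ^ 2 * z * _),
    clearingProduct]
  ring_nf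

theorem clearingProduct_mul_pow_three (q a z : ℂ) (n : ℕ) :
    clearingProduct q a (z * q ^ 3) n = clearingProduct q a z (n + 1) := by
  simp only [clearingProduct]
  ring_nf

/-- The summand of the `8n + 1` series with the `z`-dependent denominators cleared, so that it is
entire in `z`; the parameters of the theorem are `a = q^(1/2 + 3b)` and `z = q^(3c)`. -/
noncomputable def familyA (q a z : ℂ) (n : ℕ) : ℂ :=
  baileyTerm q a n * (1 - a * z * q ^ (4 * n)) * qPoch (a * z) q (2 * n) *
    (clearingProduct q a z n * qPochInf (a * z * q) (q ^ 3))

/-- The telescoping certificate for the contiguous relation of `familyA`. -/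
noncomputable def companionA (q a z : ℂ) (n : ℕ) : ℂ :=
  baileyTerm q a n * (a * z * ((1 - q ^ (2 * n)) * (q - q ^ (2 * n)))) * qPoch (a * z) q (2 * n) *
    (clearingProduct q a z n * qPochInf (a * z * q ^ 4) (q ^ 3))

theorem familyA_sub (ha : a ≠ 0) (hq1 : ‖q‖ < 1) (z : ℂ) (n : ℕ) :
    familyA q a z n - qPoch (a * z) q 3 * familyA q a (z * q ^ 3) n =
      companionA q a z (n + 1) - companionA q a z n := by
  have hinf : qPochInf (a * z * q) (q ^ 3) =
      (1 - a * z * q) * qPochInf (a * z * q ^ 4) (q ^ 3) := by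
    rw [qPochInf_eq_one_sub_mul (norm_pow_three_lt_one hq1)]
    ring_nf
  have hinf' : a * z * q ^ 3 * q = a * z * q ^ 4 := by ring
  simp only [familyA, companionA, clearingProduct_mul_pow_three, mul_add 2 n 1, mul_one 2,
    qPoch_succ _ _ (2 * n), qPoch_succ _ _ (2 * n + 1), hinf, hinf', ← mul_assoc a z,
    clearingProduct_eq hq1 a z n]
  linear_combination
    -(baileyTerm q a n * (1 - a * z * q ^ (4 * n + 3)) * clearingProduct q a z (n + 1) *
      qPochInf (a * z * q ^ 4) (q ^ 3)) * qPoch_three_mul_qPoch (a * z) q (2 * n) -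
    (z * q * qPoch (a * z) q (2 * n) * (1 - a * z * q ^ (2 * n)) * (1 - a * z * q ^ (2 * n + 1)) *
      clearingProduct q a z (n + 1) * qPochInf (a * z * q ^ 4) (q ^ 3)) * baileyTerm_succ ha hq1 n

/-- The summand of the `28n + 3` series with the `z`-dependent denominators cleared, in the same
parameters as `familyA`. The factor `(a z q^(1-3n); q³)_∞` plays the role of the Pochhammer symbol
`(q³ / (a z q); q³)_n` read backwards. -/
noncomputable def familyB (q a z : ℂ) (n : ℕ) : ℂ :=
  (baileyTerm q a (2 * n) * (1 - a * z * q ^ (5 * n)) +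
      baileyTerm q a (2 * n + 1) * (1 - a * z * q ^ n)) * qPoch (a * z) q n *
    (clearingProduct q a z n * qPochInf (a * z * q / (q ^ 3) ^ n) (q ^ 3))

/-- The telescoping certificate for the contiguous relation of `familyB`. -/
noncomputable def companionB (q a z : ℂ) (n : ℕ) : ℂ :=
  baileyTerm q a (2 * n) * (a * z * ((1 - q ^ (4 * n)) * (q - q ^ (4 * n))) / (q ^ 3) ^ n) *
    qPoch (a * z) q n *
    (clearingProduct q a z n * qPochInf (a * z * q ^ 4 / (q ^ 3) ^ n) (q ^ 3))

theorem familyB_sub (ha : a ≠ 0) (hq : q ≠ 0) (hq1 : ‖q‖ < 1) (z : ℂ) (n : ℕ) :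
    familyB q a z n - qPoch (a * z) q 3 * familyB q a (z * q ^ 3) n =
      companionB q a z (n + 1) - companionB q a z n := by
  have hinf : qPochInf (a * z * q / (q ^ 3) ^ n) (q ^ 3) =
      (1 - a * z * q / (q ^ 3) ^ n) * qPochInf (a * z * q ^ 4 / (q ^ 3) ^ n) (q ^ 3) := by
    rw [qPochInf_eq_one_sub_mul (norm_pow_three_lt_one hq1)]
    ring_nf
  have hinf' : a * z * q ^ 3 * q = a * z * q ^ 4 := by ring
  have hinf'' : a * z * q ^ 4 / (q ^ 3) ^ (n + 1) = a * z * q / (q ^ 3) ^ n := by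
    field_simp
    ring
  simp only [familyB, companionB, clearingProduct_mul_pow_three, mul_add 2 n 1, mul_one 2,
    qPoch_succ _ _ n, hinf'', hinf, hinf', ← mul_assoc a z, clearingProduct_eq hq1 a z n]
  linear_combination (norm := (field_simp; ring))
    -((baileyTerm q a (2 * n) * (1 - a * z * q ^ (5 * n + 3)) +
        baileyTerm q a (2 * n + 1) * (1 - a * z * q ^ (n + 3))) * clearingProduct q a z (n + 1) *
      qPochInf (a * z * q ^ 4 / (q ^ 3) ^ n) (q ^ 3)) * qPoch_three_mul_qPoch (a * z) q n -
    (z * q * qPoch (a * z) q n * (1 - a * z * q ^ n) / (q ^ 3) ^ (n + 1) *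
        (1 - a * z * q / (q ^ 3) ^ n) * clearingProduct q a z (n + 1) *
      qPochInf (a * z * q ^ 4 / (q ^ 3) ^ n) (q ^ 3)) * baileyTerm_succ ha hq1 (2 * n + 1) -
    (z * q * qPoch (a * z) q n * (1 - a * z * q ^ n) * (1 - a * z * q ^ (n + 1)) / (q ^ 3) ^ n *
        clearingProduct q a z (n + 1) *
      qPochInf (a * z * q ^ 4 / (q ^ 3) ^ n) (q ^ 3)) * baileyTerm_succ ha hq1 (2 * n)

theorem isBigO_clearingProduct (hq1 : ‖q‖ < 1) (a : ℂ) (R : ℝ) :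
    (fun x : ℂ × ℕ => clearingProduct q a x.1 x.2) =O[𝓟 (closedBall 0 R ×ˢ univ)]
      fun _ => (1 : ℝ) := by
  have hq3 := norm_pow_three_lt_one hq1
  refine isBigO_one_mul
    (isBigO_qPochInf hq3 (isBigO_mul_pow_closedBall hq1 R fun n => 3 * n + 3))
    (isBigO_qPochInf hq3 ?_)
  simpa only [mul_assoc] using
    (isBigO_mul_pow_closedBall hq1 R fun n => 3 * n + 2).const_mul_left (a ^ 2)

theorem isBigO_baileyTerm {ι : Type*} {l : Filter ι} (hq1 : ‖q‖ < 1) (a : ℂ) (m : ι → ℕ) :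
    (fun i => baileyTerm q a (m i)) =O[l] fun i => ‖q‖ ^ m i ^ 2 := by
  have hconst (x : ℂ) : (fun _ : ι => x) =O[l] fun _ => (1 : ℝ) := isBigO_const_one ℝ x l
  have hpow : (fun i => q ^ m i ^ 2) =O[l] fun i => ‖q‖ ^ m i ^ 2 :=
    IsBigO.of_norm_le fun i => (norm_pow q _).le
  simpa only [baileyTerm, mul_one, mul_assoc] using hpow.mul
    (isBigO_one_mul (isBigO_one_mul (isBigO_qPoch hq1 (hconst a) m)
      (isBigO_qPoch hq1 (hconst (q / a)) m)) (isBigO_inv_qPoch_self hq1 fun i => 2 * m i))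

theorem norm_pow_choose_two_mul_norm_qPochInf_div_le (hq : q ≠ 0) (hq1 : ‖q‖ < 1) (x : ℂ) (n : ℕ) :
    ‖q‖ ^ (n + 1).choose 2 * ‖qPochInf (x / q ^ n) q‖ ≤
      (1 + ‖x‖) ^ n * Real.exp (‖x‖ * (1 - ‖q‖)⁻¹) := by
  induction n with
  | zero => simpa using norm_qPochInf_le hq1 x
  | succ n ih =>
    have hdiv : x / q ^ (n + 1) * q = x / q ^ n := by
      rw [pow_succ]
      field_simp
    have hfactor : ‖q‖ ^ (n + 1) * ‖1 - x / q ^ (n + 1)‖ ≤ 1 + ‖x‖ := by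
      rw [← norm_pow, ← norm_mul, mul_sub, mul_one, mul_div_cancel₀ _ (pow_ne_zero _ hq)]
      refine (norm_sub_le _ _).trans (add_le_add_left ?_ _)
      rw [norm_pow]
      exact pow_le_one₀ (norm_nonneg _) hq1.le
    rw [qPochInf_eq_one_sub_mul hq1, hdiv, Nat.choose_succ_succ' (n + 1) 1, Nat.choose_one_right,
      pow_add, norm_mul]
    calc _ = (‖q‖ ^ (n + 1) * ‖1 - x / q ^ (n + 1)‖) *
          (‖q‖ ^ (n + 1).choose 2 * ‖qPochInf (x / q ^ n) q‖) := by ring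
      _ ≤ (1 + ‖x‖) * ((1 + ‖x‖) ^ n * Real.exp (‖x‖ * (1 - ‖q‖)⁻¹)) := by gcongr
      _ = _ := by ring

theorem pow_four_mul_sq_mul_norm_qPochInf_div_le (hq : q ≠ 0) (hq1 : ‖q‖ < 1) {x : ℂ} {R : ℝ}
    (hx : ‖x‖ ≤ R) (n : ℕ) :
    ‖q‖ ^ (4 * n ^ 2) * ‖qPochInf (x / (q ^ 3) ^ n) (q ^ 3)‖ ≤
      Real.exp (R * (1 - ‖q ^ 3‖)⁻¹) * ((1 + R) ^ n * ‖q‖ ^ n.choose 2) := by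
  have hexp (n : ℕ) : n.choose 2 + 3 * (n + 1).choose 2 ≤ 4 * n ^ 2 := by
    induction n with
    | zero => simp
    | succ n ih =>
      rw [Nat.choose_succ_succ' (n + 1) 1, Nat.choose_succ_succ' n 1, Nat.choose_one_right,
        Nat.choose_one_right] at *
      linarith
  have hq3 := norm_pow_three_lt_one hq1
  have : 0 ≤ (1 - ‖q ^ 3‖)⁻¹ := inv_nonneg.2 (sub_nonneg.2 hq3.le)
  have : 0 ≤ R := (norm_nonneg x).trans hx
  calc ‖q‖ ^ (4 * n ^ 2) * ‖qPochInf (x / (q ^ 3) ^ n) (q ^ 3)‖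
      ≤ ‖q‖ ^ (n.choose 2 + 3 * (n + 1).choose 2) * ‖qPochInf (x / (q ^ 3) ^ n) (q ^ 3)‖ := by
        gcongr ?_ * _
        exact pow_le_pow_of_le_one (norm_nonneg _) hq1.le (hexp n)
    _ = ‖q‖ ^ n.choose 2 *
        (‖q ^ 3‖ ^ (n + 1).choose 2 * ‖qPochInf (x / (q ^ 3) ^ n) (q ^ 3)‖) := by
        rw [pow_add, pow_mul, ← norm_pow q 3, mul_assoc]
    _ ≤ ‖q‖ ^ n.choose 2 * ((1 + ‖x‖) ^ n * Real.exp (‖x‖ * (1 - ‖q ^ 3‖)⁻¹)) := by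
        gcongr ?_ * ?_
        exact norm_pow_choose_two_mul_norm_qPochInf_div_le (pow_ne_zero 3 hq) hq3 _ _
    _ ≤ ‖q‖ ^ n.choose 2 * ((1 + R) ^ n * Real.exp (R * (1 - ‖q ^ 3‖)⁻¹)) := by gcongr
    _ = _ := by ring

theorem isBigO_mul_qPochInf_div_pow {ι : Type*} {s : Set ι} {f u : ι → ℂ} {m : ι → ℕ} {R : ℝ}
    (hq : q ≠ 0) (hq1 : ‖q‖ < 1) (hf : ∀ i ∈ s, ‖f i‖ ≤ R)
    (hu : u =O[𝓟 s] fun i => ‖q‖ ^ (4 * m i ^ 2)) :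
    (fun i => u i * qPochInf (f i / (q ^ 3) ^ m i) (q ^ 3)) =O[𝓟 s]
      fun i => (1 + R) ^ m i * ‖q‖ ^ (m i).choose 2 := by
  refine (hu.mul (isBigO_refl _ _).norm_right).trans
    (isBigO_principal.2 ⟨Real.exp (R * (1 - ‖q ^ 3‖)⁻¹), fun i hi => ?_⟩)
  have hR : 0 ≤ R := (norm_nonneg _).trans (hf i hi)
  rw [Real.norm_of_nonneg (by positivity), Real.norm_of_nonneg (by positivity)]
  exact pow_four_mul_sq_mul_norm_qPochInf_div_le hq hq1 (hf i hi) (m i)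

theorem continuous_familyA (hq1 : ‖q‖ < 1) (a : ℂ) (n : ℕ) :
    Continuous fun z => familyA q a z n := by
  have := continuous_qPochInf (norm_pow_three_lt_one hq1)
  have := continuous_qPoch q
  unfold familyA clearingProduct
  fun_prop

theorem continuous_familyB (hq1 : ‖q‖ < 1) (a : ℂ) (n : ℕ) :
    Continuous fun z => familyB q a z n := by
  have := continuous_qPochInf (norm_pow_three_lt_one hq1)
  have := continuous_qPoch q
  unfold familyB clearingProduct
  fun_prop

theorem familyA_zero (q a : ℂ) : familyA q a 0 = baileyTerm q a := by
  ext n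
  simp [familyA, clearingProduct, qPoch_zero_left, qPochInf_zero_left]

theorem familyB_zero (q a : ℂ) (n : ℕ) :
    familyB q a 0 n = baileyTerm q a (2 * n) + baileyTerm q a (2 * n + 1) := by
  simp [familyB, clearingProduct, qPoch_zero_left, qPochInf_zero_left]

theorem tendsto_prod_qPoch_mul_pow_three (hq1 : ‖q‖ < 1) (a z : ℂ) :
    Tendsto (fun k => ∏ j ∈ Finset.range k, qPoch (a * (z * (q ^ 3) ^ j)) q 3) atTop
      (𝓝 (qPochInf (a * z) q)) := by
  simp_rw [← mul_assoc, prod_range_qPoch_mul_pow]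
  exact (tendsto_qPoch hq1 _).comp (tendsto_id.const_mul_atTop' three_pos)

theorem isBigO_one_sub_mul_pow {ι : Type*} {l : Filter ι} {f : ι → ℂ} (hq1 : ‖q‖ < 1)
    (hf : f =O[l] fun _ => (1 : ℝ)) (m : ι → ℕ) :
    (fun i => 1 - f i * q ^ m i) =O[l] fun _ => (1 : ℝ) :=
  (isBigO_const_one ℝ (1 : ℂ) l).sub (isBigO_one_mul hf (isBigO_pow_one hq1 m))

theorem isBigO_one_sub_pow_mul_sub_pow {ι : Type*} {l : Filter ι} (hq1 : ‖q‖ < 1) (m : ι → ℕ) :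
    (fun i => (1 - q ^ m i) * (q - q ^ m i)) =O[l] fun _ => (1 : ℝ) :=
  isBigO_one_mul ((isBigO_const_one ℝ (1 : ℂ) l).sub (isBigO_pow_one hq1 m))
    ((isBigO_const_one ℝ q l).sub (isBigO_pow_one hq1 m))

theorem isBigO_mul_fst (a : ℂ) (R : ℝ) :
    (fun x : ℂ × ℕ => a * x.1) =O[𝓟 (closedBall 0 R ×ˢ univ)] fun _ => (1 : ℝ) := by
  refine (isBigO_principal.2 ⟨R, ?_⟩ : Prod.fst =O[_] _).const_mul_left a
  rintro x ⟨hx, -⟩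
  simpa using hx

theorem hasSum_familyA (ha : a ≠ 0) (hq1 : ‖q‖ < 1) (z : ℂ) :
    HasSum (familyA q a z) (qPochInf (a * z) q * ∑' n, baileyTerm q a n) := by
  have hz := isBigO_mul_fst a ‖z‖
  have hq3 := norm_pow_three_lt_one hq1
  have hbailey : (fun x : ℂ × ℕ => baileyTerm q a x.2) =O[𝓟 (closedBall 0 ‖z‖ ×ˢ univ)]
      fun x => ‖q‖ ^ x.2 ^ 2 := isBigO_baileyTerm hq1 a Prod.snd
  have hinf (m : ℕ) : (fun x : ℂ × ℕ => clearingProduct q a x.1 x.2 *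
      qPochInf (a * x.1 * q ^ m) (q ^ 3)) =O[𝓟 (closedBall 0 ‖z‖ ×ˢ univ)] fun _ => (1 : ℝ) :=
    isBigO_one_mul (isBigO_clearingProduct hq1 a ‖z‖)
      (isBigO_qPochInf hq3 (isBigO_one_mul hz (isBigO_pow_one hq1 fun _ => m)))
  have hfin := isBigO_qPoch hq1 hz fun x => 2 * x.2
  have hcert := isBigO_one_sub_pow_mul_sub_pow hq1 (l := 𝓟 (closedBall (0 : ℂ) ‖z‖ ×ˢ univ))
    fun x => 2 * x.2
  rw [← familyA_zero]
  refine hasSum_of_contiguous (c := fun w => qPoch (a * w) q 3) (G := companionA q a) hq3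
    (by simpa using summable_pow_mul_pow_sq (by simpa using hq1 : |‖q‖| < 1) 1) ?_ ?_
    (fun n => (continuous_familyA hq1 a n).continuousAt) (familyA_sub ha hq1)
    (fun w => by simp [companionA]) (tendsto_prod_qPoch_mul_pow_three hq1 a z)
  · simpa only [familyA, mul_one, pow_one] using
      ((hbailey.mul (isBigO_one_sub_mul_pow hq1 hz fun x => 4 * x.2)).mul hfin).mul (hinf 1)
  · simpa only [companionA, mul_one] using
      ((hbailey.mul (isBigO_one_mul hz hcert)).mul hfin).mul (hinf 4)

theorem norm_mul_mul_pow_le_of_mem (hq1 : ‖q‖ < 1) (a : ℂ) {R : ℝ} (m : ℕ) :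
    ∀ x ∈ closedBall (0 : ℂ) R ×ˢ (univ : Set ℕ), ‖a * x.1 * q ^ m‖ ≤ ‖a‖ * R := by
  rintro x ⟨hx, -⟩
  rw [mem_closedBall_zero_iff] at hx
  rw [norm_mul, norm_mul, norm_pow]
  exact (mul_le_of_le_one_right (by positivity) (pow_le_one₀ (norm_nonneg _) hq1.le)).trans
    (by gcongr)

theorem isBigO_baileyTerm_two_mul {ι : Type*} {l : Filter ι} (hq1 : ‖q‖ < 1) (a : ℂ) (m : ι → ℕ) :
    (fun i => baileyTerm q a (2 * m i)) =O[l] fun i => ‖q‖ ^ (4 * m i ^ 2) := by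
  simpa only [mul_pow, Nat.reducePow] using isBigO_baileyTerm hq1 a fun i => 2 * m i

theorem isBigO_familyB (hq : q ≠ 0) (hq1 : ‖q‖ < 1) (a : ℂ) (R : ℝ) :
    (fun x : ℂ × ℕ => familyB q a x.1 x.2) =O[𝓟 (closedBall 0 R ×ˢ univ)]
      fun x => (1 + ‖a‖ * R) ^ x.2 * ‖q‖ ^ x.2.choose 2 := by
  have hz := isBigO_mul_fst a R
  have hodd : (fun x : ℂ × ℕ => baileyTerm q a (2 * x.2 + 1)) =O[𝓟 (closedBall 0 R ×ˢ univ)]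
      fun x => ‖q‖ ^ (4 * x.2 ^ 2) := by
    refine (isBigO_baileyTerm hq1 a fun x : ℂ × ℕ => 2 * x.2 + 1).trans
      (IsBigO.of_norm_le fun x => ?_)
    rw [Real.norm_of_nonneg (by positivity)]
    exact pow_le_pow_of_le_one (norm_nonneg _) hq1.le (by ring_nf; lia)
  have hpoly := ((isBigO_baileyTerm_two_mul hq1 a Prod.snd).mul
    (isBigO_one_sub_mul_pow hq1 hz fun x => 5 * x.2)).add
      (hodd.mul (isBigO_one_sub_mul_pow hq1 hz fun x => x.2))
  simp only [mul_one] at hpoly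
  refine ((isBigO_mul_qPochInf_div_pow hq hq1 (norm_mul_mul_pow_le_of_mem hq1 a 1) hpoly).mul
    (isBigO_one_mul (isBigO_qPoch hq1 hz Prod.snd) (isBigO_clearingProduct hq1 a R))).congr
      (fun x => ?_) fun x => mul_one _
  simp only [familyB, pow_one]
  ring

theorem isBigO_companionB (hq : q ≠ 0) (hq1 : ‖q‖ < 1) (a : ℂ) (R : ℝ) :
    (fun x : ℂ × ℕ => companionB q a x.1 x.2) =O[𝓟 (closedBall 0 R ×ˢ univ)]
      fun x => ((1 + ‖a‖ * R) * ‖q ^ 3‖⁻¹) ^ x.2 * ‖q‖ ^ x.2.choose 2 := by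
  have hz := isBigO_mul_fst a R
  have hcert := isBigO_one_sub_pow_mul_sub_pow hq1 (l := 𝓟 (closedBall (0 : ℂ) R ×ˢ univ))
    fun x => 4 * x.2
  have hpole : (fun x : ℂ × ℕ => ((q ^ 3) ^ x.2)⁻¹) =O[𝓟 (closedBall 0 R ×ˢ univ)]
      fun x => ‖q ^ 3‖⁻¹ ^ x.2 := IsBigO.of_norm_le fun x => by simp
  refine (((isBigO_mul_qPochInf_div_pow hq hq1 (norm_mul_mul_pow_le_of_mem hq1 a 4)
    (isBigO_baileyTerm_two_mul hq1 a Prod.snd)).mul hpole).mul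
      (isBigO_one_mul (isBigO_one_mul hz hcert) (isBigO_one_mul (isBigO_qPoch hq1 hz Prod.snd)
        (isBigO_clearingProduct hq1 a R)))).congr (fun x => ?_) fun x => ?_
  · simp only [companionB, div_eq_mul_inv]
    ring
  · rw [mul_one, mul_pow]
    ring

theorem hasSum_familyB (ha : a ≠ 0) (hq : q ≠ 0) (hq1 : ‖q‖ < 1) (z : ℂ) :
    HasSum (familyB q a z) (qPochInf (a * z) q * ∑' n, baileyTerm q a n) := by
  have hq3 := norm_pow_three_lt_one hq1
  have hsum := (hasSum_baileyTerm ha hq hq1).summable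
  have hzero : ∑' n, familyB q a 0 n = ∑' n, baileyTerm q a n := by
    have heven := hsum.comp_injective (mul_right_injective₀ (two_ne_zero (α := ℕ)))
    have hodd := hsum.comp_injective
      ((add_left_injective 1).comp (mul_right_injective₀ (two_ne_zero (α := ℕ))))
    simp_rw [← tsum_even_add_odd heven hodd, familyB_zero]
    exact heven.tsum_add hodd
  have hweak : (fun x : ℂ × ℕ => (1 + ‖a‖ * ‖z‖) ^ x.2 * ‖q‖ ^ x.2.choose 2)
      =O[𝓟 (closedBall 0 ‖z‖ ×ˢ univ)]
      fun x => ((1 + ‖a‖ * ‖z‖) * ‖q ^ 3‖⁻¹) ^ x.2 * ‖q‖ ^ x.2.choose 2 := by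
    have hone : 1 ≤ ‖q ^ 3‖⁻¹ :=
      (one_le_inv₀ (norm_pos_iff.2 (pow_ne_zero 3 hq))).2 hq3.le
    refine IsBigO.of_norm_le fun x => ?_
    rw [Real.norm_of_nonneg (by positivity)]
    gcongr
    exact le_mul_of_one_le_right (by positivity) hone
  rw [← hzero]
  exact hasSum_of_contiguous (c := fun w => qPoch (a * w) q 3) (G := companionB q a) hq3
    (summable_pow_mul_pow_choose_two (by simpa using hq1) _)
    ((isBigO_familyB hq hq1 a ‖z‖).trans hweak) (isBigO_companionB hq hq1 a ‖z‖)
    (fun n => (continuous_familyB hq1 a n).continuousAt) (familyB_sub ha hq hq1)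
    (fun w => by simp [companionB]) (tendsto_prod_qPoch_mul_pow_three hq1 a z)

end ContiguousFamilies

section CpowParameters

variable {q b c a z : ℂ}

theorem cpow_eq_mul_pow (hq : q ≠ 0) (ha : q ^ (1 / 2 + 3 * b) = a) (hz : q ^ (3 * c) = z)
    (i j k : ℕ) {e : ℂ} (he : e = i * (1 / 2 + 3 * b) + j * (3 * c) + k) :
    q ^ e = a ^ i * z ^ j * q ^ k := by
  rw [he, Complex.cpow_add _ _ hq, Complex.cpow_add _ _ hq, Complex.cpow_nat_mul,
    Complex.cpow_nat_mul, Complex.cpow_natCast, ha, hz]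

theorem cpow_half_sub (hq : q ≠ 0) (ha : q ^ (1 / 2 + 3 * b) = a) :
    q ^ (1 / 2 - 3 * b) = q / a := by
  rw [← ha, show 1 / 2 - 3 * b = 1 - (1 / 2 + 3 * b) by ring, Complex.cpow_sub _ _ hq,
    Complex.cpow_one]

theorem cpow_half_add_add (hq : q ≠ 0) (ha : q ^ (1 / 2 + 3 * b) = a) (hz : q ^ (3 * c) = z) :
    q ^ (3 * b + 3 * c + 1 / 2) = a * z := by
  simpa using cpow_eq_mul_pow hq ha hz 1 1 0 (by push_cast; ring)

theorem cpow_three_halves_add (hq : q ≠ 0) (ha : q ^ (1 / 2 + 3 * b) = a)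
    (hz : q ^ (3 * c) = z) : q ^ (3 * b + 3 * c + 3 / 2) = a * z * q := by
  simpa using cpow_eq_mul_pow hq ha hz 1 1 1 (by push_cast; ring)

theorem cpow_three_halves_sub (hq : q ≠ 0) (ha : q ^ (1 / 2 + 3 * b) = a)
    (hz : q ^ (3 * c) = z) : q ^ (3 / 2 - 3 * b - 3 * c) = q ^ 3 / (a * z * q) := by
  rw [← cpow_three_halves_add hq ha hz, ← Complex.cpow_ofNat, ← Complex.cpow_sub _ _ hq]
  ring_nf

theorem cpow_three_mul_add_three (hq : q ≠ 0) (hz : q ^ (3 * c) = z) :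
    q ^ (3 * c + 3) = z * q ^ 3 := by
  rw [Complex.cpow_add _ _ hq, hz, Complex.cpow_ofNat]

theorem cpow_six_mul_add_three (hq : q ≠ 0) (ha : q ^ (1 / 2 + 3 * b) = a)
    (hz : q ^ (3 * c) = z) : q ^ (6 * b + 3 * c + 3) = a ^ 2 * z * q ^ 2 := by
  simpa using cpow_eq_mul_pow hq ha hz 2 1 2 (by push_cast; ring)

/-- The factor multiplying `q^(4n²) (a, q / a; q)_(2n) / (q; q)_(4n+2)` when the consecutive terms
`2n` and `2n + 1` of the Bailey series are grouped as in `familyB`. It is the common source of the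
polynomials `P_q` and `T_q` of the theorem. -/
noncomputable def pairFactor (q a z : ℂ) (n : ℕ) : ℂ :=
  (1 - q ^ (4 * n + 1)) * (1 - q ^ (4 * n + 2)) * (1 - a * z * q ^ (5 * n)) +
    q ^ (4 * n + 1) * (1 - a * z * q ^ n) * (1 - a * q ^ (2 * n)) * (1 - q / a * q ^ (2 * n))

theorem pow_mul_pairFactor_mul_qPoch_div (hq1 : ‖q‖ < 1) (a z : ℂ) (n : ℕ) :
    q ^ (4 * n ^ 2) * pairFactor q a z n * (qPoch a q (2 * n) * qPoch (q / a) q (2 * n)) /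
        qPoch q q (4 * n + 2) =
      baileyTerm q a (2 * n) * (1 - a * z * q ^ (5 * n)) +
        baileyTerm q a (2 * n + 1) * (1 - a * z * q ^ n) := by
  have hsucc : qPoch q q (4 * n + 2) =
      qPoch q q (4 * n) * ((1 - q ^ (4 * n + 1)) * (1 - q ^ (4 * n + 2))) := by
    rw [qPoch_succ, qPoch_succ]
    ring
  have hne := hsucc ▸ qPoch_self_ne_zero hq1 (4 * n + 2)
  have h0 := left_ne_zero_of_mul hne
  have h1 := left_ne_zero_of_mul (right_ne_zero_of_mul hne)
  have h2 := right_ne_zero_of_mul (right_ne_zero_of_mul hne)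
  rw [baileyTerm, baileyTerm, show 2 * (2 * n) = 4 * n by ring,
    show 2 * (2 * n + 1) = 4 * n + 2 by ring, hsucc, qPoch_succ, qPoch_succ, pairFactor]
  field_simp
  ring

theorem polyB_eq (hq : q ≠ 0) (ha : q ^ (1 / 2 + 3 * b) = a) (hz : q ^ (3 * c) = z) (n : ℕ) :
    polyB q b c n =
      a * q ^ 2 * (a * z * q - q ^ (3 * n)) * pairFactor q a z n := by
  have ha0 : a ≠ 0 := by simp [← ha, Complex.cpow_eq_zero_iff, hq]
  have key := cpow_eq_mul_pow hq ha hz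
  rw [polyB, pairFactor,
    key 2 1 (4 * n + 5) (e := 6 * b + 3 * c + 4 * n + 6) (by push_cast; ring),
    key 3 2 (5 * n + 3) (e := 9 * b + 6 * c + 5 * n + 9 / 2) (by push_cast; ring),
    key 3 2 (5 * n + 4) (e := 9 * b + 6 * c + 5 * n + 11 / 2) (by push_cast; ring),
    key 1 1 (6 * n + 5) (e := 3 * b + 3 * c + 6 * n + 11 / 2) (by push_cast; ring),
    key 3 1 (6 * n + 4) (e := 9 * b + 3 * c + 6 * n + 11 / 2) (by push_cast; ring),
    key 2 2 (7 * n + 5) (e := 6 * b + 6 * c + 7 * n + 6) (by push_cast; ring),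
    key 4 2 (7 * n + 4) (e := 12 * b + 6 * c + 7 * n + 6) (by push_cast; ring),
    key 2 1 (8 * n + 2) (e := 6 * b + 3 * c + 8 * n + 3) (by push_cast; ring),
    key 2 1 (8 * n + 3) (e := 6 * b + 3 * c + 8 * n + 4) (by push_cast; ring),
    key 2 1 (8 * n + 5) (e := 6 * b + 3 * c + 8 * n + 6) (by push_cast; ring),
    key 2 1 (8 * n + 6) (e := 6 * b + 3 * c + 8 * n + 7) (by push_cast; ring),
    key 3 2 (9 * n + 4) (e := 9 * b + 6 * c + 9 * n + 11 / 2) (by push_cast; ring),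
    key 1 1 (10 * n + 4) (e := 3 * b + 3 * c + 10 * n + 9 / 2) (by push_cast; ring),
    key 3 1 (10 * n + 3) (e := 9 * b + 3 * c + 10 * n + 9 / 2) (by push_cast; ring),
    key 2 1 (12 * n + 3) (e := 6 * b + 3 * c + 12 * n + 4) (by push_cast; ring),
    key 3 2 (13 * n + 6) (e := 9 * b + 6 * c + 13 * n + 15 / 2) (by push_cast; ring),
    key 2 1 (16 * n + 5) (e := 6 * b + 3 * c + 16 * n + 6) (by push_cast; ring),
    key 2 1 3 (e := 6 * b + 3 * c + 4) (by push_cast; ring),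
    key 1 0 (3 * n + 2) (e := 3 * b + 3 * n + 5 / 2) (by push_cast; ring),
    key 1 0 (7 * n + 4) (e := 3 * b + 7 * n + 9 / 2) (by push_cast; ring),
    key 2 0 (9 * n + 3) (e := 6 * b + 9 * n + 4) (by push_cast; ring),
    key 1 0 (11 * n + 4) (e := 3 * b + 11 * n + 9 / 2) (by push_cast; ring),
    key 1 0 (11 * n + 5) (e := 3 * b + 11 * n + 11 / 2) (by push_cast; ring),
    key 0 0 (9 * n + 4) (e := 9 * n + 4) (by push_cast; ring)]
  field_simp
  ring

theorem auxPolyB_eq (hq : q ≠ 0) (ha : q ^ (1 / 2 + 3 * b) = a) (n : ℕ) :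
    auxPolyB q b n = a * pairFactor q a 0 n := by
  have ha0 : a ≠ 0 := by simp [← ha, Complex.cpow_eq_zero_iff, hq]
  have key := cpow_eq_mul_pow (c := 0) hq ha rfl
  rw [auxPolyB, pairFactor,
    key 1 0 (4 * n + 2) (e := 3 * b + 4 * n + 5 / 2) (by push_cast; ring),
    key 2 0 (6 * n + 1) (e := 6 * b + 6 * n + 2) (by push_cast; ring),
    key 1 0 (8 * n + 2) (e := 3 * b + 8 * n + 5 / 2) (by push_cast; ring),
    key 1 0 (8 * n + 3) (e := 3 * b + 8 * n + 7 / 2) (by push_cast; ring),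
    key 1 0 0 (e := 3 * b + 1 / 2) (by push_cast; ring),
    key 0 0 (6 * n + 2) (e := 6 * n + 2) (by push_cast; ring)]
  field_simp
  ring

theorem cpow_mul_cpow_sub_cpow (hq : q ≠ 0) (ha : q ^ (1 / 2 + 3 * b) = a)
    (hz : q ^ (3 * c) = z) (n : ℕ) :
    q ^ (4 * b + c + 3) * (q ^ (2 * b + 2 * c + 1) - q ^ (-b - c + 3 * n - 1 / 2)) =
      a * q ^ 2 * (a * z * q - q ^ (3 * n)) := by
  have key := cpow_eq_mul_pow hq ha hz
  rw [mul_sub, ← Complex.cpow_add _ _ hq, ← Complex.cpow_add _ _ hq,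
    key 2 1 3 (by push_cast; ring), key 1 0 (3 * n + 2) (by push_cast; ring)]
  ring

theorem cpow_mul_cpow_mul_pow_choose_two (hq : q ≠ 0) (ha : q ^ (1 / 2 + 3 * b) = a)
    (hz : q ^ (3 * c) = z) (n : ℕ) :
    q ^ (3 * b * n - b + 3 * c * n - c + 5 * n ^ 2 / 2) * q ^ (4 * b + c + 3) *
        (q ^ 3) ^ (n + 1).choose 2 =
      q ^ (3 * b + 3) * q ^ (4 * n ^ 2) * (a * z * q) ^ n := by
  have hchoose : ((n + 1).choose 2 : ℂ) = (n + 1) * n / 2 := by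
    rw [Nat.cast_choose_two]
    push_cast
    ring
  rw [← cpow_three_halves_add hq ha hz, ← pow_mul, ← Complex.cpow_natCast q (3 * _),
    ← Complex.cpow_natCast q (4 * _), ← Complex.cpow_nat_mul]
  simp only [← Complex.cpow_add _ _ hq]
  push_cast
  rw [hchoose]
  ring_nf

end CpowParameters

section TwoVariable

theorem qPochInf_div_pow_mul {x q : ℂ} (hx : x ≠ 0) (hq : q ≠ 0) (hq1 : ‖q‖ < 1) (n : ℕ) :
    qPochInf (x / q ^ n) q * q ^ (n + 1).choose 2 =
      (-x) ^ n * qPoch (q / x) q n * qPochInf x q := by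
  induction n with
  | zero => simp [qPoch_zero]
  | succ n ih =>
    have hdiv : x / q ^ (n + 1) * q = x / q ^ n := by
      rw [pow_succ]
      field_simp
    have hfactor : (1 - x / q ^ (n + 1)) * q ^ (n + 1) = -x * (1 - q / x * q ^ n) := by
      field_simp
      ring
    rw [qPochInf_eq_one_sub_mul hq1, hdiv, Nat.choose_succ_succ' (n + 1) 1, Nat.choose_one_right,
      pow_add, qPoch_succ]
    linear_combination (1 - x / q ^ (n + 1)) * q ^ (n + 1) * ih +
      (-x) ^ n * qPoch (q / x) q n * qPochInf x q * hfactor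

/-- The product `(z q³, a² z q², a z q; q³)_∞`; the two-variable formulas require it not to
vanish. -/
noncomputable def poleProduct (q a z : ℂ) : ℂ :=
  clearingProduct q a z 0 * qPochInf (a * z * q) (q ^ 3)

theorem clearingProduct_zero {q : ℂ} (hq1 : ‖q‖ < 1) (a z : ℂ) (n : ℕ) :
    clearingProduct q a z 0 =
      qPoch (z * q ^ 3) (q ^ 3) n * qPoch (a ^ 2 * z * q ^ 2) (q ^ 3) n *
        clearingProduct q a z n := by
  have hq3 := norm_pow_three_lt_one hq1
  rw [clearingProduct, clearingProduct, mul_zero, zero_add, zero_add,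
    qPochInf_eq_qPoch_mul hq3 (z * q ^ 3) n, qPochInf_eq_qPoch_mul hq3 (a ^ 2 * z * q ^ 2) n]
  ring_nf

variable {q : ℝ} {a b c z : ℂ}

theorem norm_ofReal_lt_one (hq : 0 < q) (hq1 : q < 1) : ‖(q : ℂ)‖ < 1 := by
  rwa [Complex.norm_real, Real.norm_of_nonneg hq.le]

theorem ofReal_cpow_ne_zero (hq : 0 < q) (x : ℂ) : (q : ℂ) ^ x ≠ 0 := by
  simp [Complex.cpow_eq_zero_iff, hq.ne']

theorem qPochInf_cpow_ne_zero (hq : 0 < q) (hq1 : q < 1) {x : ℂ}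
    (h : ∀ j : ℕ, (q : ℂ) ^ (x + 3 * j) ≠ 1) : qPochInf ((q : ℂ) ^ x) ((q : ℂ) ^ 3) ≠ 0 := by
  refine qPochInf_ne_zero (norm_pow_three_lt_one (norm_ofReal_lt_one hq hq1)) fun j => ?_
  rw [← pow_mul, ← Complex.cpow_natCast, ← Complex.cpow_add _ _ (by exact_mod_cast hq.ne')]
  exact_mod_cast h j

theorem poleProduct_ne_zero (hq : 0 < q) (hq1 : q < 1)
    (ha : (q : ℂ) ^ (1 / 2 + 3 * b) = a) (hz : (q : ℂ) ^ (3 * c) = z)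
    (h1 : ∀ j : ℕ, (q : ℂ) ^ (3 * c + 3 + 3 * j) ≠ 1)
    (h2 : ∀ j : ℕ, (q : ℂ) ^ (6 * b + 3 * c + 3 + 3 * j) ≠ 1)
    (h3 : ∀ j : ℕ, (q : ℂ) ^ (3 * b + 3 * c + 3 / 2 + 3 * j) ≠ 1) :
    poleProduct q a z ≠ 0 := by
  have hq0 : (q : ℂ) ≠ 0 := by exact_mod_cast hq.ne'
  rw [poleProduct, clearingProduct, mul_zero, zero_add, zero_add,
    ← cpow_three_mul_add_three hq0 hz, ← cpow_six_mul_add_three hq0 ha hz,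
    ← cpow_three_halves_add hq0 ha hz]
  exact mul_ne_zero (mul_ne_zero (qPochInf_cpow_ne_zero hq hq1 h1)
    (qPochInf_cpow_ne_zero hq hq1 h2)) (qPochInf_cpow_ne_zero hq hq1 h3)

theorem termA_eq (hq : 0 < q) (hq1 : q < 1)
    (ha : (q : ℂ) ^ (1 / 2 + 3 * b) = a) (hz : (q : ℂ) ^ (3 * c) = z)
    (h : poleProduct q a z ≠ 0) (n : ℕ) :
    termA q b c n = familyA q a z n / poleProduct q a z := by
  have hq0 : (q : ℂ) ≠ 0 := by exact_mod_cast hq.ne'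
  have hpow : (q : ℂ) ^ (3 * b + 3 * c + 4 * n + 1 / 2) = a * z * (q : ℂ) ^ (4 * n) := by
    simpa using cpow_eq_mul_pow hq0 ha hz 1 1 (4 * n) (by push_cast; ring)
  have hclear := clearingProduct_zero (norm_ofReal_lt_one hq hq1) a z n
  have hden := left_ne_zero_of_mul (hclear ▸ left_ne_zero_of_mul h)
  have hden1 := left_ne_zero_of_mul hden
  have hden2 := right_ne_zero_of_mul hden
  rw [eq_div_iff h, termA, hpow, ha, cpow_half_sub hq0 ha, cpow_half_add_add hq0 ha hz,
    cpow_three_mul_add_three hq0 hz, show 3 + 6 * b + 3 * c = 6 * b + 3 * c + 3 by ring,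
    cpow_six_mul_add_three hq0 ha hz, poleProduct, hclear, familyA, baileyTerm]
  field_simp

theorem termB_eq (hq : 0 < q) (hq1 : q < 1)
    (ha : (q : ℂ) ^ (1 / 2 + 3 * b) = a) (hz : (q : ℂ) ^ (3 * c) = z)
    (h : poleProduct q a z ≠ 0) {n : ℕ}
    (hn : (q : ℂ) ^ (2 * b + 2 * c + 1) ≠ (q : ℂ) ^ (-b - c + 3 * n - 1 / 2)) :
    termB q b c n = (q : ℂ) ^ (3 * b + 3) * (familyB q a z n / poleProduct q a z) := by
  have hq0 : (q : ℂ) ≠ 0 := by exact_mod_cast hq.ne'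
  have hn1 := norm_ofReal_lt_one hq hq1
  have hazq : a * z * q ≠ 0 := by
    rw [← ha, ← hz]
    exact mul_ne_zero (mul_ne_zero (ofReal_cpow_ne_zero hq _) (ofReal_cpow_ne_zero hq _)) hq0
  have hclear := clearingProduct_zero hn1 a z n
  have hden := left_ne_zero_of_mul (hclear ▸ left_ne_zero_of_mul h)
  have hreflect := qPochInf_div_pow_mul hazq (pow_ne_zero 3 hq0) (norm_pow_three_lt_one hn1) n
  have hexp := cpow_mul_cpow_mul_pow_choose_two hq0 ha hz n
  have hpole := sub_ne_zero.2 hn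
  rw [← mul_div_assoc, eq_div_iff h, termB, polyB_eq hq0 ha hz,
    ← cpow_mul_cpow_sub_cpow hq0 ha hz, cpow_half_sub hq0 ha, add_comm (3 * b) (1 / 2), ha,
    cpow_half_add_add hq0 ha hz, cpow_three_halves_sub hq0 ha hz,
    cpow_three_mul_add_three hq0 hz, cpow_six_mul_add_three hq0 ha hz, poleProduct, hclear,
    familyB, ← pow_mul_pairFactor_mul_qPoch_div hn1]
  refine mul_right_cancel₀ (pow_ne_zero ((n + 1).choose 2) (pow_ne_zero 3 hq0)) ?_
  generalize (q : ℂ) ^ (2 * b + 2 * c + 1) - (q : ℂ) ^ (-b - c + 3 * n - 1 / 2) = pole at *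
  generalize qPoch (z * (q : ℂ) ^ 3) _ n * qPoch (a ^ 2 * z * (q : ℂ) ^ 2) _ n = denom at *
  rw [neg_pow] at hreflect
  linear_combination
    pairFactor q a z n * (qPoch a q (2 * n) * qPoch (q / a) q (2 * n)) /
        qPoch q q (4 * n + 2) * qPoch (a * z) q n * clearingProduct q a z n *
      ((q : ℂ) ^ (3 * b * n - b + 3 * c * n - c + 5 * n ^ 2 / 2) * (q : ℂ) ^ (4 * b + c + 3) *
            ((q : ℂ) ^ 3) ^ (n + 1).choose 2 * ((-1) ^ n *
            qPoch ((q : ℂ) ^ 3 / (a * z * q)) (q ^ 3) n * qPochInf (a * z * q) (q ^ 3)) *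
          (denom * denom⁻¹ * mul_inv_cancel₀ hpole + mul_inv_cancel₀ hden) +
        (-1) ^ n * qPoch ((q : ℂ) ^ 3 / (a * z * q)) (q ^ 3) n * qPochInf (a * z * q) (q ^ 3) *
          hexp -
        (q : ℂ) ^ (3 * b + 3) * (q : ℂ) ^ (4 * n ^ 2) * hreflect)

end TwoVariable

section QGamma

theorem qPoch_mul_eq_prod (a q : ℂ) (m n : ℕ) :
    qPoch a q (m * n) = ∏ i ∈ Finset.range m, qPoch (a * q ^ i) (q ^ m) n := by
  induction n with
  | zero => simp [qPoch_zero]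
  | succ n ih =>
    simp_rw [qPoch_succ _ (q ^ m), Finset.prod_mul_distrib, ← ih, Nat.mul_succ, qPoch_add]
    congr 1
    exact Finset.prod_congr rfl fun i _ => by ring

theorem qPochInf_eq_prod {q : ℂ} (hq1 : ‖q‖ < 1) (a : ℂ) {m : ℕ} (hm : m ≠ 0) :
    qPochInf a q = ∏ i ∈ Finset.range m, qPochInf (a * q ^ i) (q ^ m) := by
  have hqm : ‖q ^ m‖ < 1 := by
    rw [norm_pow]
    exact pow_lt_one₀ (norm_nonneg _) hq1 hm
  refine tendsto_nhds_unique
    ((tendsto_qPoch hq1 a).comp (tendsto_id.const_mul_atTop' (pos_of_ne_zero hm))) ?_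
  simp only [Function.comp_def, id, qPoch_mul_eq_prod]
  exact tendsto_finsetProd _ fun i _ => tendsto_qPoch hqm _

theorem ofReal_pow_cpow {q : ℝ} (hq : 0 < q) (m : ℕ) (x : ℂ) :
    ((q ^ m : ℝ) : ℂ) ^ x = (q : ℂ) ^ (m * x) := by
  rw [Complex.ofReal_pow, Complex.cpow_nat_mul' ?_ ?_] <;>
    simp [Complex.arg_ofReal_of_nonneg hq.le, Real.pi_pos, Real.pi_pos.le]

theorem inv_qGamma_mul_qGamma {q : ℝ} (hq1 : q < 1) {x y : ℂ} (hxy : x + y = 1) :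
    (qGamma q x * qGamma q y)⁻¹ = qPochInf ((q : ℂ) ^ x) q * qPochInf ((q : ℂ) ^ y) q /
      (qPochInf q q ^ 2 * (1 - q)) := by
  have hne : ((1 - q : ℝ) : ℂ) ≠ 0 := by exact_mod_cast (sub_pos.2 hq1).ne'
  have hpow : ((1 - q : ℝ) : ℂ) ^ (1 - x) * ((1 - q : ℝ) : ℂ) ^ (1 - y) = 1 - q := by
    rw [← Complex.cpow_add _ _ hne, show 1 - x + (1 - y) = 1 by linear_combination -hxy,
      Complex.cpow_one, Complex.ofReal_sub, Complex.ofReal_one]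
  rw [← hpow, qGamma, qGamma]
  simp only [mul_inv, div_eq_mul_inv, inv_inv]
  ring

variable {q : ℝ} {a b c z : ℂ}

theorem one_sub_mul_cpow (hq : 0 < q) (hq1 : q < 1) (b c : ℂ) :
    (1 - q) * ((q : ℂ) ^ 2 + q + 1) ^ (3 * b + 3 * c + 1 / 2) *
      ((1 - q ^ 3 : ℝ) : ℂ) ^ (1 - (c + 1)) * ((1 - q ^ 3 : ℝ) : ℂ) ^ (1 - (b + c + 1 / 2)) *
      ((1 - q ^ 3 : ℝ) : ℂ) ^ (1 - (2 * b + c + 1)) *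
      (((1 - q : ℝ) : ℂ) ^ (1 - (3 * b + 3 * c + 1 / 2)))⁻¹ = 1 - (q : ℂ) ^ 3 := by
  have hne : ((1 - q : ℝ) : ℂ) ≠ 0 := by exact_mod_cast (sub_pos.2 hq1).ne'
  have hne3 : ((1 - q ^ 3 : ℝ) : ℂ) ≠ 0 := by
    exact_mod_cast (sub_pos.2 (pow_lt_one₀ hq.le hq1 three_ne_zero)).ne'
  set e := 3 * b + 3 * c + 1 / 2 with he
  have hcancel : ((1 - q : ℝ) : ℂ) * (((1 - q : ℝ) : ℂ) ^ (1 - e))⁻¹ =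
      ((1 - q : ℝ) : ℂ) ^ e := by
    rw [Complex.cpow_sub _ _ hne, Complex.cpow_one]
    field_simp
  have hfactor : ((q : ℂ) ^ 2 + q + 1) ^ e * ((1 - q : ℝ) : ℂ) ^ e =
      ((1 - q ^ 3 : ℝ) : ℂ) ^ e := by
    rw [show (q : ℂ) ^ 2 + q + 1 = ((q ^ 2 + q + 1 : ℝ) : ℂ) by push_cast; rfl,
      ← Complex.mul_cpow_ofReal_nonneg (by positivity) (sub_pos.2 hq1).le, ← Complex.ofReal_mul]
    ring_nf
  have htotal : ((1 - q ^ 3 : ℝ) : ℂ) ^ e * (((1 - q ^ 3 : ℝ) : ℂ) ^ (1 - (c + 1)) *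
      ((1 - q ^ 3 : ℝ) : ℂ) ^ (1 - (b + c + 1 / 2)) *
      ((1 - q ^ 3 : ℝ) : ℂ) ^ (1 - (2 * b + c + 1))) = 1 - (q : ℂ) ^ 3 := by
    simp only [← Complex.cpow_add _ _ hne3]
    rw [show e + (1 - (c + 1) + (1 - (b + c + 1 / 2)) + (1 - (2 * b + c + 1))) = 1 by
      rw [he]; ring, Complex.cpow_one]
    push_cast
    rfl
  rw [← htotal, ← hfactor, ← hcancel]
  push_cast
  ring

/-- The normalizing factor `N(b, c)` of the theorem. -/
noncomputable def normFactor (q : ℝ) (b c : ℂ) : ℂ :=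
  (1 - q) * ((q : ℂ) ^ 2 + q + 1) ^ (3 * b + 3 * c + 1 / 2) *
    qGamma (q ^ 3) (c + 1) * qGamma (q ^ 3) (b + c + 1 / 2) * qGamma (q ^ 3) (2 * b + c + 1)

theorem normFactor_mul_inv (hq : 0 < q) (hq1 : q < 1)
    (ha : (q : ℂ) ^ (1 / 2 + 3 * b) = a) (hz : (q : ℂ) ^ (3 * c) = z) :
    normFactor q b c * (qGamma q (3 * b + 3 * c + 1 / 2))⁻¹ =
      (1 - (q : ℂ) ^ 3) * qPochInf ((q : ℂ) ^ 3) ((q : ℂ) ^ 3) ^ 3 * qPochInf (a * z) q *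
        (qPochInf q q * poleProduct q a z)⁻¹ := by
  have hq0 : (q : ℂ) ≠ 0 := by exact_mod_cast hq.ne'
  simp only [← one_sub_mul_cpow hq hq1 b c, normFactor, qGamma, ofReal_pow_cpow hq,
    poleProduct, clearingProduct, mul_zero, zero_add]
  rw [Nat.cast_ofNat, Complex.ofReal_pow, show 3 * (c + 1) = 3 * c + 3 by ring,
    show 3 * (b + c + 1 / 2) = 3 * b + 3 * c + 3 / 2 by ring,
    show 3 * (2 * b + c + 1) = 6 * b + 3 * c + 3 by ring, cpow_three_mul_add_three hq0 hz,
    cpow_three_halves_add hq0 ha hz, cpow_six_mul_add_three hq0 ha hz,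
    cpow_half_add_add hq0 ha hz]
  simp only [mul_inv, div_eq_mul_inv, inv_inv]
  ring

theorem inv_qGamma_third_mul (hq : 0 < q) (hq1 : q < 1) :
    (qGamma (q ^ 3) (1 / 3) * qGamma (q ^ 3) (2 / 3))⁻¹ =
      qPochInf q ((q : ℂ) ^ 3) * qPochInf ((q : ℂ) * q) ((q : ℂ) ^ 3) /
        (qPochInf ((q : ℂ) ^ 3) ((q : ℂ) ^ 3) ^ 2 * (1 - (q : ℂ) ^ 3)) := by
  have hone : (q : ℂ) ^ (3 * (1 / 3) : ℂ) = q := by norm_num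
  have htwo : (q : ℂ) ^ (3 * (2 / 3) : ℂ) = (q : ℂ) * q := by
    rw [← sq, ← Complex.cpow_natCast]
    norm_num
  rw [inv_qGamma_mul_qGamma (pow_lt_one₀ hq.le hq1 three_ne_zero) (by norm_num),
    ofReal_pow_cpow hq, ofReal_pow_cpow hq, Nat.cast_ofNat, hone, htwo, Complex.ofReal_pow]

theorem inv_qGamma_half_mul (hq : 0 < q) (hq1 : q < 1) (ha : (q : ℂ) ^ (1 / 2 + 3 * b) = a) :
    (qGamma (q ^ 3) (1 / 2 - b) * qGamma (q ^ 3) (b + 1 / 2))⁻¹ =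
      qPochInf ((q : ℂ) ^ 2 / a) ((q : ℂ) ^ 3) * qPochInf (a * q) ((q : ℂ) ^ 3) /
        (qPochInf ((q : ℂ) ^ 3) ((q : ℂ) ^ 3) ^ 2 * (1 - (q : ℂ) ^ 3)) := by
  have hq0 : (q : ℂ) ≠ 0 := by exact_mod_cast hq.ne'
  have hsub : (q : ℂ) ^ (3 * (1 / 2 - b)) = (q : ℂ) ^ 2 / a := by
    rw [← ha, ← Complex.cpow_ofNat, ← Complex.cpow_sub _ _ hq0]
    ring_nf
  have hadd : (q : ℂ) ^ (3 * (b + 1 / 2)) = a * q := by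
    rw [← ha, show 3 * (b + 1 / 2) = 1 / 2 + 3 * b + 1 by ring, Complex.cpow_add _ _ hq0,
      Complex.cpow_one]
  rw [inv_qGamma_mul_qGamma (pow_lt_one₀ hq.le hq1 three_ne_zero) (by ring),
    ofReal_pow_cpow hq, ofReal_pow_cpow hq, Nat.cast_ofNat, hsub, hadd, Complex.ofReal_pow]

theorem normFactor_div_third (hq : 0 < q) (hq1 : q < 1)
    (ha : (q : ℂ) ^ (1 / 2 + 3 * b) = a) (hz : (q : ℂ) ^ (3 * c) = z) :
    normFactor q b c / (qGamma (q ^ 3) (1 / 3) * qGamma (q ^ 3) (2 / 3) *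
        qGamma q (3 * b + 3 * c + 1 / 2)) = qPochInf (a * z) q / poleProduct q a z := by
  have hn := norm_ofReal_lt_one hq hq1
  have h1 : 1 - (q : ℂ) ^ 3 ≠ 0 := by
    exact_mod_cast (sub_pos.2 (pow_lt_one₀ hq.le hq1 three_ne_zero)).ne'
  have hsplit : qPochInf (q : ℂ) q = qPochInf (q : ℂ) (q ^ 3) * qPochInf ((q : ℂ) * q) (q ^ 3) *
      qPochInf ((q : ℂ) ^ 3) (q ^ 3) := by
    rw [qPochInf_eq_prod hn _ three_ne_zero]
    simp only [Finset.prod_range_succ, Finset.prod_range_zero]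
    ring_nf
  have hne := qPochInf_ne_zero_of_norm_lt hn hn
  rw [div_eq_mul_inv, mul_inv, mul_left_comm, normFactor_mul_inv hq hq1 ha hz,
    inv_qGamma_third_mul hq hq1, mul_inv, div_eq_mul_inv _ (poleProduct _ _ _)]
  rw [hsplit] at hne ⊢
  obtain ⟨⟨hne1, hne2⟩, hne3⟩ := by simpa only [mul_ne_zero_iff] using hne
  generalize qPochInf (q : ℂ) ((q : ℂ) ^ 3) = X at *
  generalize qPochInf ((q : ℂ) * q) ((q : ℂ) ^ 3) = Y at *
  field_simp

theorem normFactor_div_half (hq : 0 < q) (hq1 : q < 1)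
    (ha : (q : ℂ) ^ (1 / 2 + 3 * b) = a) (hz : (q : ℂ) ^ (3 * c) = z) :
    normFactor q b c / (qGamma (q ^ 3) (1 / 2 - b) * qGamma (q ^ 3) (b + 1 / 2) *
        qGamma q (3 * b + 3 * c + 1 / 2)) =
      qPochInf (a * z) q / poleProduct q a z * ∑' n, baileyTerm q a n := by
  have hq0 : (q : ℂ) ≠ 0 := by exact_mod_cast hq.ne'
  have hn := norm_ofReal_lt_one hq hq1
  have hn3 := norm_pow_three_lt_one hn
  have h1 : 1 - (q : ℂ) ^ 3 ≠ 0 := by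
    exact_mod_cast (sub_pos.2 (pow_lt_one₀ hq.le hq1 three_ne_zero)).ne'
  have hne := qPochInf_ne_zero_of_norm_lt hn3 hn3
  rw [(hasSum_baileyTerm (ha ▸ ofReal_cpow_ne_zero hq _) hq0 hn).tsum_eq,
    div_eq_mul_inv, mul_inv, mul_left_comm, normFactor_mul_inv hq hq1 ha hz,
    inv_qGamma_half_mul hq hq1 ha, mul_inv, div_eq_mul_inv _ (poleProduct _ _ _)]
  field_simp

end QGamma

section TwoVariableSums

variable {q : ℝ} {a b c z : ℂ}

theorem auxA_eq (hq : q ≠ 0) (ha : (q : ℂ) ^ (1 / 2 + 3 * b) = a) :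
    auxA q b = baileyTerm q a := by
  ext n
  rw [auxA, baileyTerm, cpow_half_sub (by exact_mod_cast hq) ha, ha, div_eq_mul_inv,
    mul_comm (qPoch _ _ _)]

theorem auxB_eq (hq : 0 < q) (hq1 : q < 1) (ha : (q : ℂ) ^ (1 / 2 + 3 * b) = a) (n : ℕ) :
    auxB q b n = a * familyB q a 0 n := by
  have hq0 : (q : ℂ) ≠ 0 := by exact_mod_cast hq.ne'
  have hpair := pow_mul_pairFactor_mul_qPoch_div (norm_ofReal_lt_one hq hq1) a 0 n
  simp only [mul_zero, zero_mul, sub_zero, mul_one] at hpair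
  rw [auxB, auxPolyB_eq hq0 ha, cpow_half_sub hq0 ha, add_comm (3 * b), ha, familyB_zero, ← hpair]
  ring

theorem hasSum_auxB (hq : 0 < q) (hq1 : q < 1) (ha : (q : ℂ) ^ (1 / 2 + 3 * b) = a) :
    HasSum (auxB q b) (a * ∑' n, baileyTerm q a n) := by
  rw [funext (auxB_eq hq hq1 ha)]
  simpa [qPochInf_zero_left] using (hasSum_familyB (ha ▸ ofReal_cpow_ne_zero hq _)
    (by exact_mod_cast hq.ne') (norm_ofReal_lt_one hq hq1) 0).mul_left a

theorem hasSum_termA (hq : 0 < q) (hq1 : q < 1) (ha : (q : ℂ) ^ (1 / 2 + 3 * b) = a)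
    (hz : (q : ℂ) ^ (3 * c) = z) (h : poleProduct q a z ≠ 0) :
    HasSum (termA q b c) (qPochInf (a * z) q / poleProduct q a z * ∑' n, baileyTerm q a n) := by
  rw [funext (termA_eq hq hq1 ha hz h), div_mul_eq_mul_div]
  exact (hasSum_familyA (ha ▸ ofReal_cpow_ne_zero hq _) (norm_ofReal_lt_one hq hq1) z).div_const _

theorem hasSum_termB (hq : 0 < q) (hq1 : q < 1) (ha : (q : ℂ) ^ (1 / 2 + 3 * b) = a)
    (hz : (q : ℂ) ^ (3 * c) = z) (h : poleProduct q a z ≠ 0)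
    (hn : ∀ n : ℕ, (q : ℂ) ^ (2 * b + 2 * c + 1) ≠ (q : ℂ) ^ (-b - c + 3 * n - 1 / 2)) :
    HasSum (termB q b c) ((q : ℂ) ^ (3 * b + 3) *
      (qPochInf (a * z) q / poleProduct q a z * ∑' n, baileyTerm q a n)) := by
  rw [show termB q b c = _ from funext fun n => termB_eq hq hq1 ha hz h (hn n), div_mul_eq_mul_div]
  exact ((hasSum_familyB (ha ▸ ofReal_cpow_ne_zero hq _) (by exact_mod_cast hq.ne')
    (norm_ofReal_lt_one hq hq1) z).div_const _).mul_left _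

theorem two_variable_formulas (hq : 0 < q) (hq1 : q < 1)
    (h1 : ∀ j : ℕ, (q : ℂ) ^ (3 * c + 3 + 3 * j) ≠ 1)
    (h2 : ∀ j : ℕ, (q : ℂ) ^ (6 * b + 3 * c + 3 + 3 * j) ≠ 1)
    (h3 : ∀ j : ℕ, (q : ℂ) ^ (3 * b + 3 * c + 3 / 2 + 3 * j) ≠ 1) :
    (Summable (auxA q b) ∧ HasSum (termA q b c)
      (normFactor q b c / (qGamma (q ^ 3) (1 / 3) * qGamma (q ^ 3) (2 / 3) *
        qGamma q (3 * b + 3 * c + 1 / 2)) * ∑' n, auxA q b n)) ∧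
    HasSum (termA q b c) (normFactor q b c / (qGamma (q ^ 3) (1 / 2 - b) *
      qGamma (q ^ 3) (b + 1 / 2) * qGamma q (3 * b + 3 * c + 1 / 2))) ∧
    ((∀ n : ℕ, (q : ℂ) ^ (2 * b + 2 * c + 1) ≠ (q : ℂ) ^ (-b - c + 3 * n - 1 / 2)) →
      (Summable (auxB q b) ∧ HasSum (fun n => (q : ℂ) ^ (-(5 / 2) : ℂ) * termB q b c n)
        (normFactor q b c / (qGamma (q ^ 3) (1 / 3) * qGamma (q ^ 3) (2 / 3) *
          qGamma q (3 * b + 3 * c + 1 / 2)) * ∑' n, auxB q b n)) ∧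
      HasSum (termB q b c) ((q : ℂ) ^ (3 * b + 3) * normFactor q b c /
        (qGamma (q ^ 3) (1 / 2 - b) * qGamma (q ^ 3) (b + 1 / 2) *
          qGamma q (3 * b + 3 * c + 1 / 2)))) := by
  obtain ⟨a, ha⟩ : ∃ a, (q : ℂ) ^ (1 / 2 + 3 * b) = a := ⟨_, rfl⟩
  obtain ⟨z, hz⟩ : ∃ z, (q : ℂ) ^ (3 * c) = z := ⟨_, rfl⟩
  have hq0 : (q : ℂ) ≠ 0 := by exact_mod_cast hq.ne'
  have hpole := poleProduct_ne_zero hq hq1 ha hz h1 h2 h3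
  have hA := hasSum_termA hq hq1 ha hz hpole
  have hauxA := hasSum_baileyTerm (ha ▸ ofReal_cpow_ne_zero hq _) hq0 (norm_ofReal_lt_one hq hq1)
  have hauxB := hasSum_auxB hq hq1 ha
  have hshift : (q : ℂ) ^ (-(5 / 2) : ℂ) * (q : ℂ) ^ (3 * b + 3) = a := by
    rw [← ha, ← Complex.cpow_add _ _ hq0]
    ring_nf
  rw [auxA_eq hq.ne' ha, mul_div_assoc, normFactor_div_third hq hq1 ha hz,
    normFactor_div_half hq hq1 ha hz]
  refine ⟨⟨hauxA.summable, hA⟩, hA, fun hn => ?_⟩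
  have hB := hasSum_termB hq hq1 ha hz hpole hn
  refine ⟨⟨hauxB.summable, ?_⟩, hB⟩
  have hB' := hB.mul_left ((q : ℂ) ^ (-(5 / 2) : ℂ))
  rwa [← mul_assoc, hshift, ← mul_left_comm, ← hauxB.tsum_eq] at hB'

end TwoVariableSums

section Specialization

theorem qGamma_one {q : ℝ} (hq : 0 < q) (hq1 : q < 1) : qGamma q 1 = 1 := by
  have hn := norm_ofReal_lt_one hq hq1
  rw [qGamma, Complex.cpow_one, div_self (qPochInf_ne_zero_of_norm_lt hn hn), sub_self,
    Complex.cpow_zero, mul_one]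

theorem qGamma_ne_zero {q : ℝ} (hq : 0 < q) (hq1 : q < 1) {x : ℂ} (hx : 0 < x.re) :
    qGamma q x ≠ 0 := by
  have hn := norm_ofReal_lt_one hq hq1
  have hqx : ‖(q : ℂ) ^ x‖ < 1 := by
    rw [Complex.norm_cpow_eq_rpow_re_of_pos hq]
    exact Real.rpow_lt_one hq.le hq1 hx
  exact mul_ne_zero (div_ne_zero (qPochInf_ne_zero_of_norm_lt hn hn)
    (qPochInf_ne_zero_of_norm_lt hn hqx)) (ofReal_cpow_ne_zero (sub_pos.2 hq1) _)

theorem ofReal_pow_cpow_eq_pow {q : ℝ} (hq : 0 < q) (k m : ℕ) {x : ℂ} (hx : k * x = m) :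
    ((q ^ k : ℝ) : ℂ) ^ x = (q : ℂ) ^ m := by
  rw [ofReal_pow_cpow hq, hx, Complex.cpow_natCast]

theorem ofReal_cpow_ne_of_re_ne {q : ℝ} (hq : 0 < q) (hq1 : q < 1) {x y : ℂ} (h : x.re ≠ y.re) :
    (q : ℂ) ^ x ≠ (q : ℂ) ^ y := fun heq => by
  have hnorm := congrArg norm heq
  rw [Complex.norm_cpow_eq_rpow_re_of_pos hq, Complex.norm_cpow_eq_rpow_re_of_pos hq] at hnorm
  exact h ((Real.rpow_right_inj hq hq1.ne).1 hnorm)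

theorem ofReal_cpow_ne_one_of_re_ne_zero {q : ℝ} (hq : 0 < q) (hq1 : q < 1) {x : ℂ}
    (h : x.re ≠ 0) : (q : ℂ) ^ x ≠ 1 := by
  simpa using ofReal_cpow_ne_of_re_ne hq hq1 (y := 0) h

theorem pairFactor_sq_one {q : ℂ} (hq : q ≠ 0) (n : ℕ) :
    pairFactor (q ^ 2) q 1 n = polyB₀ q n * ((1 - q ^ (4 * n + 1)) * (1 - q ^ (2 * n + 1))) := by
  rw [pairFactor, polyB₀, show q ^ 2 / q = q by field_simp]
  ring

theorem qPoch_sq_self_four_mul_add_two (q : ℂ) (n : ℕ) :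
    qPoch (q ^ 2) (q ^ 2) (4 * n + 2) =
      (1 - q ^ (4 * n + 1)) * (1 - q ^ (2 * n + 1)) * ((q ^ (2 * n + 1) + 1) *
        (q ^ (4 * n + 1) + 1) * (q ^ (4 * n + 2) + 1) * qPoch (q ^ 2) (q ^ 2) (4 * n)) := by
  rw [qPoch_succ, qPoch_succ]
  ring

variable {q : ℝ}

theorem termA_sq_zero_zero (hq : 0 < q) (n : ℕ) : termA (q ^ 2) 0 0 n = termA₀ q n := by
  rw [termA, termA₀,
    ofReal_pow_cpow_eq_pow hq 2 (8 * n + 1) (x := 3 * 0 + 3 * 0 + 4 * n + 1 / 2)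
      (by push_cast; ring),
    ofReal_pow_cpow_eq_pow hq 2 1 (x := 1 / 2 - 3 * 0) (by norm_num),
    ofReal_pow_cpow_eq_pow hq 2 1 (x := 1 / 2 + 3 * 0) (by norm_num),
    ofReal_pow_cpow_eq_pow hq 2 1 (x := 3 * 0 + 3 * 0 + 1 / 2) (by norm_num),
    ofReal_pow_cpow_eq_pow hq 2 6 (x := 3 * 0 + 3) (by norm_num),
    ofReal_pow_cpow_eq_pow hq 2 6 (x := 3 + 6 * 0 + 3 * 0) (by norm_num), Complex.ofReal_pow,
    ← pow_mul, ← pow_mul]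
  ring_nf

theorem termB_sq_zero_zero (hq : 0 < q) (hq1 : q < 1) {n : ℕ}
    (hn : ((q ^ 2 : ℝ) : ℂ) ^ (2 * 0 + 2 * 0 + 1 : ℂ) ≠
      ((q ^ 2 : ℝ) : ℂ) ^ (-0 - 0 + 3 * n - 1 / 2 : ℂ)) :
    termB (q ^ 2) 0 0 n = (q : ℂ) ^ 6 * termB₀ q n := by
  have hq0 : (q : ℂ) ≠ 0 := by exact_mod_cast hq.ne'
  have hsq0 : ((q ^ 2 : ℝ) : ℂ) ≠ 0 := by exact_mod_cast (pow_pos hq 2).ne'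
  have hsq1 := norm_ofReal_lt_one (pow_pos hq 2) (pow_lt_one₀ hq.le hq1 two_ne_zero)
  have ha : ((q ^ 2 : ℝ) : ℂ) ^ (1 / 2 + 3 * 0 : ℂ) = q := by
    simpa using ofReal_pow_cpow_eq_pow hq 2 1 (x := 1 / 2 + 3 * 0) (by norm_num)
  have hz : ((q ^ 2 : ℝ) : ℂ) ^ (3 * 0 : ℂ) = 1 := by simp
  have hden := qPoch_self_ne_zero hsq1 (4 * n + 2)
  have hpole := sub_ne_zero.2 hn
  rw [termB, termB₀, polyB_eq hsq0 ha hz, ← cpow_mul_cpow_sub_cpow hsq0 ha hz,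
    ofReal_pow_cpow_eq_pow hq 2 (5 * n ^ 2)
      (x := 3 * 0 * n - 0 + 3 * 0 * n - 0 + 5 * n ^ 2 / 2) (by push_cast; ring),
    ofReal_pow_cpow_eq_pow hq 2 1 (x := 1 / 2 - 3 * 0) (by norm_num), add_comm (3 * 0 : ℂ) (1 / 2),
    ha, cpow_half_add_add hsq0 ha hz,
    ofReal_pow_cpow_eq_pow hq 2 3 (x := 3 / 2 - 3 * 0 - 3 * 0) (by norm_num),
    ofReal_pow_cpow_eq_pow hq 2 6 (x := 3 * 0 + 3) (by norm_num),
    ofReal_pow_cpow_eq_pow hq 2 6 (x := 6 * 0 + 3 * 0 + 3) (by norm_num),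
    ofReal_pow_cpow_eq_pow hq 2 6 (x := 4 * 0 + 0 + 3) (by norm_num)]
  generalize ((q ^ 2 : ℝ) : ℂ) ^ (2 * 0 + 2 * 0 + 1 : ℂ) -
      ((q ^ 2 : ℝ) : ℂ) ^ (-0 - 0 + 3 * n - 1 / 2 : ℂ) = pole at *
  rw [Complex.ofReal_pow, qPoch_sq_self_four_mul_add_two] at hden ⊢
  have hcommon := left_ne_zero_of_mul hden
  rw [pairFactor_sq_one hq0, ← pow_mul, pow_one, mul_one]
  generalize (1 - (q : ℂ) ^ (4 * n + 1)) * (1 - (q : ℂ) ^ (2 * n + 1)) = common at *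
  rw [← mul_div_assoc, eq_comm, ← mul_div_mul_left _ _ (mul_ne_zero hpole hcommon)]
  congr 1 <;> ring

theorem normFactor_sq_zero_zero_div (hq : 0 < q) (hq1 : q < 1) :
    normFactor (q ^ 2) 0 0 / (qGamma ((q ^ 2) ^ 3) (1 / 2 - 0) * qGamma ((q ^ 2) ^ 3) (0 + 1 / 2) *
      qGamma (q ^ 2) (3 * 0 + 3 * 0 + 1 / 2)) = rhs₀ q := by
  have hq6 : 0 < q ^ 6 := pow_pos hq 6
  have hq61 : q ^ 6 < 1 := pow_lt_one₀ hq.le hq1 (by norm_num)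
  have hsqrt : (((q ^ 2 : ℝ) : ℂ) ^ 2 + (q ^ 2 : ℝ) + 1) ^ (1 / 2 : ℂ) =
      ((√(q ^ 4 + q ^ 2 + 1) : ℝ) : ℂ) := by
    rw [Real.sqrt_eq_rpow, Complex.ofReal_cpow (by positivity)]
    push_cast
    ring_nf
  have hhalf := qGamma_ne_zero hq6 hq61 (x := 1 / 2) (by norm_num)
  rw [normFactor, rhs₀, show (q ^ 2) ^ 3 = q ^ 6 by ring]
  simp only [mul_zero, zero_add, sub_zero, qGamma_one hq6 hq61, mul_one, hsqrt]
  push_cast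
  field_simp

theorem hasSum_termA₀_and_hasSum_termB₀ (hq : 0 < q) (hq1 : q < 1) :
    HasSum (fun n => termA₀ q n) (rhs₀ q) ∧ HasSum (fun n => termB₀ q n) (rhs₀ q) := by
  have hq2 : 0 < q ^ 2 := pow_pos hq 2
  have hq21 : q ^ 2 < 1 := pow_lt_one₀ hq.le hq1 two_ne_zero
  have hn (n : ℕ) : ((q ^ 2 : ℝ) : ℂ) ^ (2 * 0 + 2 * 0 + 1 : ℂ) ≠
      ((q ^ 2 : ℝ) : ℂ) ^ (-0 - 0 + 3 * n - 1 / 2 : ℂ) :=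
    ofReal_cpow_ne_of_re_ne hq2 hq21 fun h => by
      norm_num at h
      have : (3 : ℝ) = (6 * n : ℕ) := by push_cast; linarith
      have : 3 = 6 * n := by exact_mod_cast this
      omega
  obtain ⟨-, hA, hB⟩ := two_variable_formulas hq2 hq21 (b := 0) (c := 0)
    (fun j => ofReal_cpow_ne_one_of_re_ne_zero hq2 hq21 (by norm_num; positivity))
    (fun j => ofReal_cpow_ne_one_of_re_ne_zero hq2 hq21 (by norm_num; positivity))
    (fun j => ofReal_cpow_ne_one_of_re_ne_zero hq2 hq21 (by norm_num; positivity))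
  have hB := (hB hn).2
  rw [normFactor_sq_zero_zero_div hq hq1, funext (termA_sq_zero_zero hq)] at hA
  rw [mul_div_assoc, normFactor_sq_zero_zero_div hq hq1,
    ofReal_pow_cpow_eq_pow hq 2 6 (by norm_num),
    show termB (q ^ 2) 0 0 = _ from funext fun n => termB_sq_zero_zero hq hq1 (hn n)] at hB
  exact ⟨hA, (hasSum_mul_left_iff (pow_ne_zero 6 (by exact_mod_cast hq.ne'))).1 hB⟩

end Specialization

section ClassicalTerms

theorem one_sub_pow_eq_mul_geom_sum (q : ℝ) (m : ℕ) :
    1 - q ^ m = (1 - q) * ∑ i ∈ Finset.range m, q ^ i := by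
  rw [mul_comm, geom_sum_mul_neg]

theorem tendsto_pow_nhdsLT_one (m : ℕ) : Tendsto (fun q : ℝ => q ^ m) (𝓝[<] 1) (𝓝 1) := by
  simpa using ((continuous_pow m).tendsto (1 : ℝ)).mono_left nhdsWithin_le_nhds

theorem tendsto_one_sub_pow_div_one_sub (m : ℕ) :
    Tendsto (fun q : ℝ => (1 - q ^ m) / (1 - q)) (𝓝[<] 1) (𝓝 m) := by
  have hsum : Tendsto (fun q : ℝ => ∑ i ∈ Finset.range m, q ^ i) (𝓝[<] 1) (𝓝 m) := by
    simpa using tendsto_finsetSum (Finset.range m) fun i _ => tendsto_pow_nhdsLT_one i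
  refine hsum.congr' ?_
  filter_upwards [self_mem_nhdsWithin] with q hq
  rw [one_sub_pow_eq_mul_geom_sum, mul_div_cancel_left₀ _ (sub_pos.2 hq).ne']

theorem tendsto_one_sub_pow_div_one_sub_pow (m : ℕ) {l : ℕ} (hl : l ≠ 0) :
    Tendsto (fun q : ℝ => (1 - q ^ m) / (1 - q ^ l)) (𝓝[<] 1) (𝓝 (m / l)) := by
  refine ((tendsto_one_sub_pow_div_one_sub m).div (tendsto_one_sub_pow_div_one_sub l)
    (Nat.cast_ne_zero.2 hl)).congr' ?_
  filter_upwards [self_mem_nhdsWithin] with q hq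
  exact div_div_div_cancel_right₀ (sub_pos.2 hq).ne' _ _

/-- The ratio of the terms of index `k + 1` and `k` of `(1/2)ₙ (1/4)ₙ (3/4)ₙ / (1)ₙ ^ 3`. -/
noncomputable def classicalRatio (k : ℕ) : ℝ :=
  (2 * k + 1) * (4 * k + 1) * (4 * k + 3) / (32 * (k + 1) ^ 3)

/-- The ratio of the terms of index `k + 1` and `k` of `termA₀ q n / (1 - q ^ (8 * n + 1))`. -/
noncomputable def ratioA (q : ℝ) (k : ℕ) : ℝ :=
  q ^ (4 * k + 2) * ((1 - q ^ (4 * k + 1)) / (1 - q ^ (4 * k + 2))) *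
    ((1 - q ^ (4 * k + 3)) / (1 - q ^ (4 * k + 4))) *
    ((1 - q ^ (2 * k + 1)) / (1 - q ^ (6 * k + 6))) ^ 2

/-- The ratio of the terms of index `k + 1` and `k` of `termB₀`, stripped of the factors
`polyB₀ q n` and `(q ^ (2 * n + 1) + 1) * (q ^ (4 * n + 1) + 1) * (q ^ (4 * n + 2) + 1)`. -/
noncomputable def ratioB (q : ℝ) (k : ℕ) : ℝ :=
  -(q ^ (10 * k + 5) * ((1 - q ^ (2 * k + 1)) / (1 - q ^ (6 * k + 6))) *
    ((1 - q ^ (6 * k + 3)) / (1 - q ^ (6 * k + 6))) *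
    ((1 - q ^ (4 * k + 1)) / (1 - q ^ (8 * k + 2)) *
      ((1 - q ^ (4 * k + 1)) / (1 - q ^ (8 * k + 4)))) *
    ((1 - q ^ (4 * k + 3)) / (1 - q ^ (8 * k + 6)) *
      ((1 - q ^ (4 * k + 3)) / (1 - q ^ (8 * k + 8)))))

theorem poch_zero (x : ℝ) : poch x 0 = 1 := by simp [poch]

theorem poch_succ (x : ℝ) (n : ℕ) : poch x (n + 1) = poch x n * (x + n) := by
  simp [poch, ascPochhammer_succ_eval]

theorem poch_one_ne_zero (n : ℕ) : poch 1 n ≠ 0 := (ascPochhammer_pos n 1 one_pos).ne'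

theorem pow_mul_poch_quotient_eq_prod (x : ℝ) (n : ℕ) :
    x ^ n * (poch (1 / 2) n * poch (1 / 4) n * poch (3 / 4) n / poch 1 n ^ 3) =
      ∏ k ∈ Finset.range n, x * classicalRatio k := by
  induction n with
  | zero => simp [poch_zero]
  | succ n ih =>
    have := poch_one_ne_zero n
    rw [Finset.prod_range_succ, ← ih, classicalRatio]
    simp only [poch_succ, add_comm (1 : ℝ) n]
    field_simp
    ring

theorem qPoch_quotient_eq_prod_ratioA (q : ℝ) (n : ℕ) :
    (q : ℂ) ^ (2 * n ^ 2) * qPoch q ((q : ℂ) ^ 2) (2 * n) * qPoch q ((q : ℂ) ^ 2) n ^ 2 /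
      (qPoch ((q : ℂ) ^ 2) ((q : ℂ) ^ 2) (2 * n) * qPoch ((q : ℂ) ^ 6) ((q : ℂ) ^ 6) n ^ 2) =
      ((∏ k ∈ Finset.range n, ratioA q k : ℝ) : ℂ) := by
  induction n with
  | zero => simp [qPoch_zero]
  | succ n ih =>
    rw [Finset.prod_range_succ, Complex.ofReal_mul, ← ih, ratioA, Nat.mul_succ]
    simp only [qPoch_succ]
    push_cast
    simp only [div_eq_mul_inv, mul_inv, mul_pow, ← inv_pow]
    ring

theorem qPoch_quotient_eq_prod_ratioB (q : ℝ) (n : ℕ) :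
    (-1) ^ n * (q : ℂ) ^ (5 * n ^ 2) * qPoch q ((q : ℂ) ^ 2) n *
      qPoch ((q : ℂ) ^ 3) ((q : ℂ) ^ 6) n * qPoch q ((q : ℂ) ^ 2) (2 * n) ^ 2 /
      (qPoch ((q : ℂ) ^ 2) ((q : ℂ) ^ 2) (4 * n) * qPoch ((q : ℂ) ^ 6) ((q : ℂ) ^ 6) n ^ 2) =
      ((∏ k ∈ Finset.range n, ratioB q k : ℝ) : ℂ) := by
  induction n with
  | zero => simp [qPoch_zero]
  | succ n ih =>
    rw [Finset.prod_range_succ, Complex.ofReal_mul, ← ih, ratioB, Nat.mul_succ, Nat.mul_succ]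
    simp only [qPoch_succ]
    push_cast
    simp only [div_eq_mul_inv, mul_inv, mul_pow, ← inv_pow]
    ring

theorem termA₀_eq_mul_prod_ratioA (q : ℝ) (n : ℕ) :
    termA₀ q n = (((1 - q ^ (8 * n + 1)) * ∏ k ∈ Finset.range n, ratioA q k : ℝ) : ℂ) := by
  rw [Complex.ofReal_mul, ← qPoch_quotient_eq_prod_ratioA, termA₀]
  push_cast
  ring

/-- The sum of `1 - q ^ m` over a list of exponents `m`. -/
noncomputable def oneSubPowSum (L : List ℕ) (q : ℝ) : ℝ := (L.map fun m => 1 - q ^ m).sum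

/-- The exponents of the monomials of `polyB₀ q n` with coefficient `-1`. -/
def negExponents (n : ℕ) : List ℕ :=
  [10 * n + 1, 12 * n + 2, 12 * n + 3, 14 * n + 2, 14 * n + 3, 16 * n + 3, 16 * n + 4,
    18 * n + 4, 20 * n + 5]

/-- The exponents of the nonconstant monomials of `polyB₀ q n` with coefficient `1`. -/
def posExponents (n : ℕ) : List ℕ :=
  [2 * n + 1, 4 * n + 1, 4 * n + 2, 6 * n + 2, 6 * n + 3, 8 * n + 2, 8 * n + 3, 10 * n + 4]

theorem sum_negExponents (n : ℕ) : (negExponents n).sum = 132 * n + 27 := by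
  simp only [negExponents, List.sum_cons, List.sum_nil]
  ring

theorem sum_posExponents (n : ℕ) : (posExponents n).sum = 48 * n + 18 := by
  simp only [posExponents, List.sum_cons, List.sum_nil]
  ring

theorem polyB₀_eq_oneSubPowSum_sub (q : ℝ) (n : ℕ) :
    polyB₀ q n = ((oneSubPowSum (negExponents n) q - oneSubPowSum (posExponents n) q : ℝ) : ℂ) := by
  simp only [polyB₀, oneSubPowSum, negExponents, posExponents, List.map_cons, List.map_nil,
    List.sum_cons, List.sum_nil]
  push_cast
  ring

theorem termB₀_eq_mul_prod_ratioB (q : ℝ) (n : ℕ) :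
    termB₀ q n = (((oneSubPowSum (negExponents n) q - oneSubPowSum (posExponents n) q) /
      ((q ^ (2 * n + 1) + 1) * (q ^ (4 * n + 1) + 1) * (q ^ (4 * n + 2) + 1)) *
      ∏ k ∈ Finset.range n, ratioB q k : ℝ) : ℂ) := by
  rw [Complex.ofReal_mul, ← qPoch_quotient_eq_prod_ratioB, termB₀, Complex.ofReal_div,
    ← polyB₀_eq_oneSubPowSum_sub, div_mul_div_comm]
  push_cast
  congr 1 <;> ring

theorem tendsto_ratioA (k : ℕ) :
    Tendsto (fun q => ratioA q k) (𝓝[<] 1) (𝓝 (1 / 9 * classicalRatio k)) := by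
  have h := (((tendsto_pow_nhdsLT_one (4 * k + 2)).mul
    (tendsto_one_sub_pow_div_one_sub_pow (4 * k + 1) (l := 4 * k + 2) (by omega))).mul
    (tendsto_one_sub_pow_div_one_sub_pow (4 * k + 3) (l := 4 * k + 4) (by omega))).mul
    ((tendsto_one_sub_pow_div_one_sub_pow (2 * k + 1) (l := 6 * k + 6) (by omega)).pow 2)
  convert h using 2
  · rw [ratioA]
  rw [classicalRatio]
  push_cast
  field_simp
  ring

theorem tendsto_ratioB (k : ℕ) :
    Tendsto (fun q => ratioB q k) (𝓝[<] 1) (𝓝 (-1 / 48 * classicalRatio k)) := by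
  have h := (((((tendsto_pow_nhdsLT_one (10 * k + 5)).mul
    (tendsto_one_sub_pow_div_one_sub_pow (2 * k + 1) (l := 6 * k + 6) (by omega))).mul
    (tendsto_one_sub_pow_div_one_sub_pow (6 * k + 3) (l := 6 * k + 6) (by omega))).mul
    ((tendsto_one_sub_pow_div_one_sub_pow (4 * k + 1) (l := 8 * k + 2) (by omega)).mul
    (tendsto_one_sub_pow_div_one_sub_pow (4 * k + 1) (l := 8 * k + 4) (by omega)))).mul
    ((tendsto_one_sub_pow_div_one_sub_pow (4 * k + 3) (l := 8 * k + 6) (by omega)).mul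
    (tendsto_one_sub_pow_div_one_sub_pow (4 * k + 3) (l := 8 * k + 8) (by omega)))).neg
  convert h using 2
  · rw [ratioB]
  rw [classicalRatio]
  push_cast
  field_simp
  ring

theorem tendsto_oneSubPowSum_div_one_sub (L : List ℕ) :
    Tendsto (fun q => oneSubPowSum L q / (1 - q)) (𝓝[<] 1) (𝓝 L.sum) := by
  induction L with
  | nil => simp [oneSubPowSum]
  | cons m L ih =>
    simpa [oneSubPowSum, add_div] using (tendsto_one_sub_pow_div_one_sub m).add ih

theorem tendsto_termA₀ (n : ℕ) :
    Tendsto (fun q : ℝ => termA₀ q n / (1 - q)) (𝓝[<] 1) (𝓝 (classicalA n)) := by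
  have hreal := (tendsto_one_sub_pow_div_one_sub (8 * n + 1)).mul
    (tendsto_finsetProd (Finset.range n) fun k _ => tendsto_ratioA k)
  rw [← pow_mul_poch_quotient_eq_prod] at hreal
  convert (Complex.continuous_ofReal.tendsto _).comp hreal using 2 with q
  · rw [termA₀_eq_mul_prod_ratioA, Function.comp]
    push_cast
    ring
  · rw [classicalA]
    push_cast
    ring

theorem tendsto_termB₀ (n : ℕ) :
    Tendsto (fun q : ℝ => termB₀ q n / (1 - q)) (𝓝[<] 1) (𝓝 (3 / 8 * classicalB n)) := by
  have hden := (((tendsto_pow_nhdsLT_one (2 * n + 1)).add_const 1).mul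
    ((tendsto_pow_nhdsLT_one (4 * n + 1)).add_const 1)).mul
    ((tendsto_pow_nhdsLT_one (4 * n + 2)).add_const 1)
  have hnum := (tendsto_oneSubPowSum_div_one_sub (negExponents n)).sub
    (tendsto_oneSubPowSum_div_one_sub (posExponents n))
  have hreal := (hnum.div hden (by norm_num)).mul
    (tendsto_finsetProd (Finset.range n) fun k _ => tendsto_ratioB k)
  rw [← pow_mul_poch_quotient_eq_prod, sum_negExponents, sum_posExponents] at hreal
  convert (Complex.continuous_ofReal.tendsto _).comp hreal using 2 with q
  · rw [termB₀_eq_mul_prod_ratioB]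
    simp only [Function.comp, Pi.div_apply]
    push_cast
    ring
  · rw [classicalB]
    push_cast
    ring

end ClassicalTerms

section DominatedTerms

variable {q : ℝ}

theorem one_sub_pow_nonneg (hq : 0 < q) (hq1 : q < 1) (m : ℕ) : 0 ≤ 1 - q ^ m :=
  sub_nonneg.2 (pow_le_one₀ hq.le hq1.le)

theorem one_sub_pow_pos (hq : 0 < q) (hq1 : q < 1) {m : ℕ} (hm : m ≠ 0) : 0 < 1 - q ^ m :=
  sub_pos.2 (pow_lt_one₀ hq.le hq1 hm)

theorem one_sub_pow_le_mul_one_sub (hq : 0 < q) (m : ℕ) : 1 - q ^ m ≤ m * (1 - q) := by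
  have := one_add_mul_sub_le_pow (by linarith : -1 ≤ q) m
  linarith

theorem oneSubPowSum_nonneg (hq : 0 < q) (hq1 : q < 1) (L : List ℕ) : 0 ≤ oneSubPowSum L q := by
  refine List.sum_nonneg fun x hx => ?_
  obtain ⟨m, -, rfl⟩ := List.mem_map.1 hx
  exact one_sub_pow_nonneg hq hq1 m

theorem oneSubPowSum_le_sum_mul_one_sub (hq : 0 < q) (L : List ℕ) :
    oneSubPowSum L q ≤ L.sum * (1 - q) := by
  induction L with
  | nil => simp [oneSubPowSum]
  | cons m L ih =>
    simpa [oneSubPowSum, add_mul] using add_le_add (one_sub_pow_le_mul_one_sub hq m) ih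

theorem pow_mem_unitInterval (hq : 0 < q) (hq1 : q < 1) (m : ℕ) : q ^ m ∈ unitInterval :=
  ⟨by positivity, pow_le_one₀ hq.le hq1.le⟩

theorem one_sub_pow_div_mem_unitInterval (hq : 0 < q) (hq1 : q < 1) {m l : ℕ} (h : m ≤ l) :
    (1 - q ^ m) / (1 - q ^ l) ∈ unitInterval :=
  unitInterval.div_mem (one_sub_pow_nonneg hq hq1 m) (one_sub_pow_nonneg hq hq1 l)
    (sub_le_sub_left (pow_le_pow_of_le_one hq.le hq1.le h) 1)

theorem pow_mul_one_sub_pow_div_le (hq : 0 < q) (hq1 : q < 1) {m l : ℕ} (h : m ≤ l) (hl : l ≠ 0) :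
    q ^ l * ((1 - q ^ m) / (1 - q ^ (3 * l))) ≤ 1 / 3 := by
  have hml : q ^ l ≤ q ^ m := pow_le_pow_of_le_one hq.le hq1.le h
  have hl0 : 0 < q ^ l := pow_pos hq l
  rw [← mul_div_assoc, div_le_div_iff₀ (one_sub_pow_pos hq hq1 (by omega)) (by norm_num),
    mul_comm 3, pow_mul]
  nlinarith [mul_le_mul_of_nonneg_left hml hl0.le,
    mul_nonneg (one_sub_pow_nonneg hq hq1 l) (sq_nonneg (1 - q ^ l))]

theorem abs_mul_le_one_third (hq : 0 < q) (hq1 : q < 1) (k : ℕ) {x : ℝ} (hx : x ∈ unitInterval) :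
    |q ^ (2 * k + 2) * ((1 - q ^ (2 * k + 1)) / (1 - q ^ (6 * k + 6))) * x| ≤ 1 / 3 := by
  have hle := pow_mul_one_sub_pow_div_le hq hq1 (m := 2 * k + 1) (l := 2 * k + 2) (by omega)
    (by omega)
  have hmem := one_sub_pow_div_mem_unitInterval hq hq1 (m := 2 * k + 1) (l := 6 * k + 6) (by omega)
  rw [show 3 * (2 * k + 2) = 6 * k + 6 by ring] at hle
  rw [abs_mul, abs_of_nonneg (mul_nonneg (by positivity) hmem.1), abs_of_nonneg hx.1]
  exact (mul_le_of_le_one_right (mul_nonneg (by positivity) hmem.1) hx.2).trans hle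

theorem abs_ratioA_le (hq : 0 < q) (hq1 : q < 1) (k : ℕ) : |ratioA q k| ≤ 1 / 3 := by
  have hdiv {m l : ℕ} (h : m ≤ l) := one_sub_pow_div_mem_unitInterval hq hq1 h
  convert abs_mul_le_one_third hq hq1 k (unitInterval.mul_mem (unitInterval.mul_mem
    (unitInterval.mul_mem (pow_mem_unitInterval hq hq1 (2 * k))
      (hdiv (show 4 * k + 1 ≤ 4 * k + 2 by omega)))
      (hdiv (show 4 * k + 3 ≤ 4 * k + 4 by omega)))
      (hdiv (show 2 * k + 1 ≤ 6 * k + 6 by omega))) using 2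
  rw [ratioA]
  ring

theorem abs_ratioB_le (hq : 0 < q) (hq1 : q < 1) (k : ℕ) : |ratioB q k| ≤ 1 / 3 := by
  have hdiv {m l : ℕ} (h : m ≤ l) := one_sub_pow_div_mem_unitInterval hq hq1 h
  have hmem := unitInterval.mul_mem (unitInterval.mul_mem (unitInterval.mul_mem
    (pow_mem_unitInterval hq hq1 (8 * k + 3)) (hdiv (show 6 * k + 3 ≤ 6 * k + 6 by omega)))
    (unitInterval.mul_mem (hdiv (show 4 * k + 1 ≤ 8 * k + 2 by omega))
      (hdiv (show 4 * k + 1 ≤ 8 * k + 4 by omega))))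
    (unitInterval.mul_mem (hdiv (show 4 * k + 3 ≤ 8 * k + 6 by omega))
      (hdiv (show 4 * k + 3 ≤ 8 * k + 8 by omega)))
  rw [ratioB, abs_neg]
  convert abs_mul_le_one_third hq hq1 k hmem using 2
  ring

theorem norm_ofReal_mul_prod_div_le {u a C r : ℝ} {f : ℕ → ℝ} (hu : 0 < u) (ha : |a| ≤ C * u)
    (hf : ∀ k, |f k| ≤ r) (n : ℕ) :
    ‖((a * ∏ k ∈ Finset.range n, f k : ℝ) : ℂ) / (u : ℂ)‖ ≤ C * r ^ n := by
  rw [← Complex.ofReal_div, Complex.norm_real, Real.norm_eq_abs, mul_div_right_comm, abs_mul,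
    abs_div, abs_of_pos hu, Finset.abs_prod]
  have hprod : ∏ k ∈ Finset.range n, |f k| ≤ r ^ n := by
    simpa using Finset.prod_le_prod (s := Finset.range n) (fun k _ => abs_nonneg (f k))
      fun k _ => hf k
  have hC : |a| / u ≤ C := (div_le_iff₀ hu).2 ha
  exact mul_le_mul hC hprod (Finset.prod_nonneg fun k _ => abs_nonneg (f k))
    ((div_nonneg (abs_nonneg a) hu.le).trans hC)

theorem norm_termA₀_div_le (hq : 0 < q) (hq1 : q < 1) (n : ℕ) :
    ‖termA₀ q n / (1 - q)‖ ≤ (8 * n + 1) * (1 / 3) ^ n := by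
  have hpref : |1 - q ^ (8 * n + 1)| ≤ (8 * n + 1) * (1 - q) := by
    rw [abs_of_nonneg (one_sub_pow_nonneg hq hq1 _)]
    exact_mod_cast one_sub_pow_le_mul_one_sub hq (8 * n + 1)
  rw [termA₀_eq_mul_prod_ratioA]
  exact_mod_cast norm_ofReal_mul_prod_div_le (sub_pos.2 hq1) hpref (abs_ratioA_le hq hq1) n

theorem norm_termB₀_div_le (hq : 0 < q) (hq1 : q < 1) (n : ℕ) :
    ‖termB₀ q n / (1 - q)‖ ≤ (132 * n + 27) * (1 / 3) ^ n := by
  have hneg := oneSubPowSum_le_sum_mul_one_sub hq (negExponents n)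
  have hpos := oneSubPowSum_le_sum_mul_one_sub hq (posExponents n)
  rw [sum_negExponents] at hneg
  rw [sum_posExponents] at hpos
  push_cast at hneg hpos
  have hpoly : |oneSubPowSum (negExponents n) q - oneSubPowSum (posExponents n) q| ≤
      (132 * n + 27) * (1 - q) :=
    abs_sub_le_of_nonneg_of_le (oneSubPowSum_nonneg hq hq1 _) hneg (oneSubPowSum_nonneg hq hq1 _)
      (hpos.trans (mul_le_mul_of_nonneg_right (by linarith [n.cast_nonneg (α := ℝ)])
        (sub_pos.2 hq1).le))
  have hone (m : ℕ) : 1 ≤ q ^ m + 1 := le_add_of_nonneg_left (by positivity)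
  have hden := one_le_mul_of_one_le_of_one_le
    (one_le_mul_of_one_le_of_one_le (hone (2 * n + 1)) (hone (4 * n + 1))) (hone (4 * n + 2))
  have hpref := (abs_div _ _).trans_le (div_le_self (abs_nonneg _) (hden.trans (le_abs_self _)))
    |>.trans hpoly
  rw [termB₀_eq_mul_prod_ratioB]
  exact_mod_cast norm_ofReal_mul_prod_div_le (sub_pos.2 hq1) hpref (abs_ratioB_le hq hq1) n

theorem summable_linear_mul_geometric (a b : ℝ) {r : ℝ} (hr : ‖r‖ < 1) :
    Summable fun n : ℕ => (a * n + b) * r ^ n := by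
  refine (((summable_pow_mul_geometric_of_norm_lt_one 1 hr).mul_left a).add
    ((summable_geometric_of_norm_lt_one hr).mul_left b)).congr fun n => ?_
  ring

theorem hasSum_of_tendsto_of_dominated {α β G : Type*} [NormedAddCommGroup G] [CompleteSpace G]
    {l : Filter α} [l.NeBot] {f : α → β → G} {g : β → G} {F : α → G} {v : G} {bound : β → ℝ}
    (hbound : Summable bound) (hfg : ∀ b, Tendsto (f · b) l (𝓝 (g b)))
    (hle : ∀ᶠ a in l, ∀ b, ‖f a b‖ ≤ bound b) (hF : ∀ᶠ a in l, HasSum (f a) (F a))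
    (hFv : Tendsto F l (𝓝 v)) : HasSum g v := by
  have htsum := tendsto_tsum_of_dominated_convergence hbound hfg hle
  have hv : Tendsto (fun a => ∑' b, f a b) l (𝓝 v) :=
    hFv.congr' (hF.mono fun a ha => ha.tsum_eq.symm)
  rw [← tendsto_nhds_unique htsum hv]
  exact (Summable.of_norm_bounded hbound fun b =>
    le_of_tendsto (hfg b).norm (hle.mono fun a ha => ha b)).hasSum

end DominatedTerms

section Wallis

/-- The excess over `1` of the `k`-th factor
`(1 - q ^ (2 * k + 2)) ^ 2 / ((1 - q ^ (2 * k + 1)) * (1 - q ^ (2 * k + 3)))` of the `q`-analogue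
of Wallis' product. -/
noncomputable def wallisTerm (q : ℝ) (k : ℕ) : ℝ :=
  q ^ (2 * k + 1) * ((1 - q) / (1 - q ^ (2 * k + 1))) * ((1 - q) / (1 - q ^ (2 * k + 3)))

theorem tendsto_wallisTerm (k : ℕ) :
    Tendsto (fun q => wallisTerm q k) (𝓝[<] 1) (𝓝 (1 / ((2 * k + 1) * (2 * k + 3)))) := by
  have h := ((tendsto_pow_nhdsLT_one (2 * k + 1)).mul
    (tendsto_one_sub_pow_div_one_sub_pow 1 (l := 2 * k + 1) (by omega))).mul
    (tendsto_one_sub_pow_div_one_sub_pow 1 (l := 2 * k + 3) (by omega))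
  simp only [pow_one] at h
  convert h using 2
  · rw [wallisTerm]
  push_cast
  field_simp

theorem mul_pow_le_geom_sum {q : ℝ} (hq : 0 ≤ q) (j : ℕ) :
    (2 * j + 1) * q ^ j ≤ ∑ i ∈ Finset.range (2 * j + 1), q ^ i := by
  induction j with
  | zero => simp
  | succ j ih =>
    have hstep : ∑ i ∈ Finset.range (2 * (j + 1) + 1), q ^ i =
        1 + q * (∑ i ∈ Finset.range (2 * j + 1), q ^ i) + (q ^ (j + 1)) ^ 2 := by
      rw [Nat.mul_succ, Finset.sum_range_succ, Finset.sum_range_succ', Finset.mul_sum]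
      simp only [pow_succ']
      ring
    have amgm : 2 * q ^ (j + 1) ≤ 1 + (q ^ (j + 1)) ^ 2 := by
      nlinarith [sq_nonneg (1 - q ^ (j + 1))]
    calc (2 * ((j + 1 : ℕ) : ℝ) + 1) * q ^ (j + 1)
        = q * ((2 * j + 1) * q ^ j) + 2 * q ^ (j + 1) := by
          push_cast
          ring
      _ ≤ q * (∑ i ∈ Finset.range (2 * j + 1), q ^ i) + (1 + (q ^ (j + 1)) ^ 2) := by gcongr
      _ = _ := by
          rw [hstep]
          ring

variable {q : ℝ}

theorem one_sub_div_one_sub_pow_le (hq : 0 < q) (hq1 : q < 1) (j : ℕ) :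
    q ^ j * ((1 - q) / (1 - q ^ (2 * j + 1))) ≤ 1 / (2 * j + 1) := by
  rw [← mul_div_assoc, div_le_div_iff₀ (one_sub_pow_pos hq hq1 (by omega)) (by positivity),
    one_sub_pow_eq_mul_geom_sum]
  linarith [mul_le_mul_of_nonneg_left (mul_pow_le_geom_sum hq.le j) (sub_pos.2 hq1).le]

theorem wallisTerm_nonneg (hq : 0 < q) (hq1 : q < 1) (k : ℕ) : 0 ≤ wallisTerm q k := by
  have hdiv (l : ℕ) : 0 ≤ (1 - q) / (1 - q ^ l) :=
    div_nonneg (sub_pos.2 hq1).le (one_sub_pow_nonneg hq hq1 l)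
  exact mul_nonneg (mul_nonneg (by positivity) (hdiv _)) (hdiv _)

theorem wallisTerm_le (hq : 0 < q) (hq1 : q < 1) (k : ℕ) :
    wallisTerm q k ≤ 1 / ((2 * k + 1) * (2 * k + 3)) := by
  have hnext := one_sub_div_one_sub_pow_le hq hq1 (k + 1)
  have hnonneg : 0 ≤ q ^ (k + 1) * ((1 - q) / (1 - q ^ (2 * (k + 1) + 1))) :=
    mul_nonneg (by positivity) (div_nonneg (sub_pos.2 hq1).le (one_sub_pow_nonneg hq hq1 _))
  calc wallisTerm q k = q ^ k * ((1 - q) / (1 - q ^ (2 * k + 1))) *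
        (q ^ (k + 1) * ((1 - q) / (1 - q ^ (2 * (k + 1) + 1)))) := by
        rw [wallisTerm]
        ring_nf
    _ ≤ 1 / (2 * k + 1) * (1 / (2 * (k + 1 : ℕ) + 1)) :=
        mul_le_mul (one_sub_div_one_sub_pow_le hq hq1 k) hnext hnonneg (by positivity)
    _ = 1 / ((2 * k + 1) * (2 * k + 3)) := by
        push_cast
        field_simp
        ring

theorem summable_one_div_two_mul_add_one_mul :
    Summable fun k : ℕ => (1 : ℝ) / ((2 * k + 1) * (2 * k + 3)) := by
  have hsq := (summable_nat_add_iff 1).2 (Real.summable_one_div_nat_pow.2 one_lt_two)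
  refine hsq.of_nonneg_of_le (fun k => by positivity) fun k => ?_
  push_cast
  gcongr
  nlinarith [k.cast_nonneg (α := ℝ)]

theorem tprod_wallis : ∏' k : ℕ, (1 + (1 : ℝ) / ((2 * k + 1) * (2 * k + 3))) = Real.pi / 2 := by
  have hmul := Real.multipliable_one_add_of_summable summable_one_div_two_mul_add_one_mul
  refine tendsto_nhds_unique hmul.hasProd.tendsto_prod_nat ?_
  refine Real.tendsto_prod_pi_div_two.congr fun n => Finset.prod_congr rfl fun k _ => ?_
  field_simp
  ring

theorem tendsto_tprod_wallisTerm :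
    Tendsto (fun q => ∏' k : ℕ, (1 + wallisTerm q k)) (𝓝[<] 1) (𝓝 (Real.pi / 2)) := by
  rw [← tprod_wallis]
  refine tendsto_tprod_one_add_of_dominated_convergence summable_one_div_two_mul_add_one_mul
    tendsto_wallisTerm ?_
  filter_upwards [Ioo_mem_nhdsLT one_pos] with q hq k
  rw [Real.norm_of_nonneg (wallisTerm_nonneg hq.1 hq.2 k)]
  exact wallisTerm_le hq.1 hq.2 k

theorem one_add_wallisTerm (hq : 0 < q) (hq1 : q < 1) (k : ℕ) :
    1 + wallisTerm q k =
      (1 - q ^ (2 * k + 2)) ^ 2 / ((1 - q ^ (2 * k + 1)) * (1 - q ^ (2 * k + 3))) := by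
  have h1 := (one_sub_pow_pos hq hq1 (m := 2 * k + 1) (by omega)).ne'
  have h3 := (one_sub_pow_pos hq hq1 (m := 2 * k + 3) (by omega)).ne'
  rw [wallisTerm, eq_div_iff (mul_ne_zero h1 h3)]
  field_simp
  ring

theorem prod_one_add_wallisTerm (hq : 0 < q) (hq1 : q < 1) (n : ℕ) :
    ((∏ k ∈ Finset.range n, (1 + wallisTerm q k) : ℝ) : ℂ) =
      (1 - q) * (qPoch ((q : ℂ) ^ 2) ((q : ℂ) ^ 2) n / qPoch q ((q : ℂ) ^ 2) n) ^ 2 /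
        (1 - q ^ (2 * n + 1)) := by
  induction n with
  | zero =>
    have h : (1 : ℂ) - q ≠ 0 := by exact_mod_cast (sub_pos.2 hq1).ne'
    simp [qPoch_zero, h]
  | succ n ih =>
    rw [Finset.prod_range_succ, Complex.ofReal_mul, ih, one_add_wallisTerm hq hq1, qPoch_succ,
      qPoch_succ, ← pow_mul, ← pow_succ', ← pow_add, add_comm 2 (2 * n), Nat.mul_succ]
    push_cast
    simp only [div_eq_mul_inv, mul_inv]
    ring

theorem qGamma_half_sq (hq : 0 < q) (hq1 : q < 1) :
    qGamma (q ^ 2) (1 / 2) ^ 2 = (((1 + q) * ∏' k : ℕ, (1 + wallisTerm q k) : ℝ) : ℂ) := by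
  have hn := norm_ofReal_lt_one hq hq1
  have hn2 : ‖(q : ℂ) ^ 2‖ < 1 := by
    simpa only [norm_pow] using pow_lt_one₀ (norm_nonneg _) hn two_ne_zero
  have hs : Summable (wallisTerm q) := summable_one_div_two_mul_add_one_mul.of_nonneg_of_le
    (wallisTerm_nonneg hq hq1) (wallisTerm_le hq hq1)
  have hpartial := (Complex.continuous_ofReal.tendsto _).comp
    (Real.multipliable_one_add_of_summable hs).hasProd.tendsto_prod_nat
  have hodd : Tendsto (fun n : ℕ => (q : ℂ) ^ (2 * n + 1)) atTop (𝓝 0) :=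
    (tendsto_pow_atTop_nhds_zero_of_norm_lt_one hn).comp
      (tendsto_atTop_mono (fun n => (by omega : n ≤ 2 * n + 1)) tendsto_id)
  have hlim : Tendsto (fun n : ℕ => (1 - (q : ℂ)) * (qPoch ((q : ℂ) ^ 2) ((q : ℂ) ^ 2) n /
      qPoch q ((q : ℂ) ^ 2) n) ^ 2 / (1 - (q : ℂ) ^ (2 * n + 1))) atTop
      (𝓝 ((1 - (q : ℂ)) * (qPochInf ((q : ℂ) ^ 2) ((q : ℂ) ^ 2) /
        qPochInf q ((q : ℂ) ^ 2)) ^ 2 / (1 - 0))) :=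
    ((((tendsto_qPoch hn2 _).div (tendsto_qPoch hn2 _)
      (qPochInf_ne_zero_of_norm_lt hn2 hn)).pow 2).const_mul _).div (hodd.const_sub 1) (by norm_num)
  have htprod := tendsto_nhds_unique
    (hpartial.congr fun n => prod_one_add_wallisTerm hq hq1 n) hlim
  have hpow : (((1 - q ^ 2 : ℝ) : ℂ) ^ (1 - 1 / 2 : ℂ)) ^ 2 = ((1 - q ^ 2 : ℝ) : ℂ) := by
    rw [← Complex.cpow_nat_mul]
    norm_num
  rw [Complex.ofReal_mul, htprod, qGamma, mul_pow, hpow,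
    ofReal_pow_cpow_eq_pow hq 2 1 (x := 1 / 2) (by norm_num), pow_one]
  push_cast
  ring

open scoped ComplexOrder in
theorem qPochInf_ofReal_nonneg {a : ℝ} (ha : a ≤ 1) (hq : 0 < q) (hq1 : q < 1) :
    0 ≤ qPochInf a q := by
  refine ge_of_tendsto' (tendsto_qPoch (norm_ofReal_lt_one hq hq1) a) fun n =>
    Finset.prod_nonneg fun k _ => ?_
  exact_mod_cast sub_nonneg.2 (mul_le_one₀ ha (pow_nonneg hq.le k) (pow_le_one₀ hq.le hq1.le))

theorem qGamma_half_eq_norm (hq : 0 < q) (hq1 : q < 1) :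
    qGamma (q ^ 2) (1 / 2) = ‖qGamma (q ^ 2) (1 / 2)‖ := by
  have hq2 : 0 < q ^ 2 := pow_pos hq 2
  have hq21 : q ^ 2 < 1 := pow_lt_one₀ hq.le hq1 two_ne_zero
  have hnum := Complex.eq_coe_norm_of_nonneg (qPochInf_ofReal_nonneg hq21.le hq2 hq21)
  have hden := Complex.eq_coe_norm_of_nonneg (qPochInf_ofReal_nonneg hq1.le hq2 hq21)
  have hpow : ((1 - q ^ 2 : ℝ) : ℂ) ^ (1 - 1 / 2 : ℂ) =
      (((1 - q ^ 2) ^ (1 - 1 / 2 : ℝ) : ℝ) : ℂ) := by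
    rw [Complex.ofReal_cpow (sub_pos.2 hq21).le]
    push_cast
    rfl
  have hnorm : ‖(((1 - q ^ 2) ^ (1 - 1 / 2 : ℝ) : ℝ) : ℂ)‖ = (1 - q ^ 2) ^ (1 - 1 / 2 : ℝ) :=
    Complex.norm_of_nonneg (Real.rpow_nonneg (sub_pos.2 hq21).le _)
  rw [qGamma, ofReal_pow_cpow_eq_pow hq 2 1 (x := 1 / 2) (by norm_num), pow_one, hpow, norm_mul,
    norm_div, hnorm, Complex.ofReal_mul, Complex.ofReal_div, ← hnum, ← hden]

theorem qGamma_half_eq (hq : 0 < q) (hq1 : q < 1) :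
    qGamma (q ^ 2) (1 / 2) = ((√((1 + q) * ∏' k : ℕ, (1 + wallisTerm q k)) : ℝ) : ℂ) := by
  have hsq := qGamma_half_sq hq hq1
  rw [qGamma_half_eq_norm hq hq1] at hsq ⊢
  rw [← Complex.ofReal_pow, Complex.ofReal_inj] at hsq
  rw [← hsq, Real.sqrt_sq (norm_nonneg _)]

theorem tendsto_qGamma_half :
    Tendsto (fun q : ℝ => qGamma (q ^ 2) (1 / 2)) (𝓝[<] 1) (𝓝 ((√Real.pi : ℝ) : ℂ)) := by
  have hwallis : Tendsto (fun q : ℝ => (1 + q) * ∏' k : ℕ, (1 + wallisTerm q k)) (𝓝[<] 1)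
      (𝓝 ((1 + 1) * (Real.pi / 2))) :=
    ((tendsto_id.mono_left nhdsWithin_le_nhds).const_add 1).mul tendsto_tprod_wallisTerm
  rw [one_add_one_eq_two, mul_div_cancel₀ _ two_ne_zero] at hwallis
  refine ((Complex.continuous_ofReal.tendsto _).comp hwallis.sqrt).congr' ?_
  filter_upwards [Ioo_mem_nhdsLT one_pos] with q hq
  exact (qGamma_half_eq hq.1 hq.2).symm

end Wallis

section ClassicalSeries

theorem tendsto_rhs₀ : Tendsto (fun q : ℝ => rhs₀ q / (1 - q)) (𝓝[<] 1)
    (𝓝 ((2 * √3 / Real.pi : ℝ) : ℂ)) := by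
  have hcube : Tendsto (fun q : ℝ => q ^ 3) (𝓝[<] 1) (𝓝[<] 1) := by
    refine tendsto_nhdsWithin_iff.2 ⟨tendsto_pow_nhdsLT_one 3, ?_⟩
    filter_upwards [Ioo_mem_nhdsLT one_pos] with q hq
    exact pow_lt_one₀ hq.1.le hq.2 three_ne_zero
  have hnum : Tendsto (fun q : ℝ => (((1 + q) * √(q ^ 4 + q ^ 2 + 1) : ℝ) : ℂ)) (𝓝[<] 1)
      (𝓝 ((2 * √3 : ℝ) : ℂ)) := by
    have hcont : Continuous fun q : ℝ => (((1 + q) * √(q ^ 4 + q ^ 2 + 1) : ℝ) : ℂ) := by fun_prop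
    convert (hcont.tendsto 1).mono_left (nhdsWithin_le_nhds (s := Iio 1)) using 2
    norm_num
  have hpi : ((√Real.pi : ℝ) : ℂ) * ((√Real.pi : ℝ) : ℂ) = (Real.pi : ℂ) := by
    rw [← Complex.ofReal_mul, Real.mul_self_sqrt Real.pi_pos.le]
  have hlim := hnum.div (tendsto_qGamma_half.mul (tendsto_qGamma_half.comp hcube))
    (by rw [hpi]; exact_mod_cast Real.pi_ne_zero)
  rw [hpi, ← Complex.ofReal_div] at hlim
  refine hlim.congr' ?_
  filter_upwards [self_mem_nhdsWithin] with q hq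
  have hne : (1 : ℂ) - q ≠ 0 := by exact_mod_cast (sub_pos.2 hq).ne'
  have hfactor : (((1 - q ^ 2) * √(q ^ 4 + q ^ 2 + 1) : ℝ) : ℂ) =
      (1 - q) * (((1 + q) * √(q ^ 4 + q ^ 2 + 1) : ℝ) : ℂ) := by
    push_cast
    ring
  simp only [Pi.div_apply, Function.comp, ← pow_mul, Nat.reduceMul, rhs₀]
  rw [hfactor, mul_div_assoc, mul_div_cancel_left₀ _ hne]

theorem hasSum_classicalA : HasSum classicalA (2 * √3 / Real.pi) := by
  have hev : ∀ᶠ q : ℝ in 𝓝[<] 1, q ∈ Ioo 0 1 := Ioo_mem_nhdsLT one_pos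
  rw [← Complex.hasSum_ofReal]
  exact hasSum_of_tendsto_of_dominated (summable_linear_mul_geometric 8 1 (by norm_num))
    tendsto_termA₀ (hev.mono fun q hq => norm_termA₀_div_le hq.1 hq.2)
    (hev.mono fun q hq => (hasSum_termA₀_and_hasSum_termB₀ hq.1 hq.2).1.div_const _) tendsto_rhs₀

theorem hasSum_classicalB : HasSum classicalB (16 / (√3 * Real.pi)) := by
  have hev : ∀ᶠ q : ℝ in 𝓝[<] 1, q ∈ Ioo 0 1 := Ioo_mem_nhdsLT one_pos
  have hscaled : HasSum (fun n => 3 / 8 * classicalB n) (2 * √3 / Real.pi) := by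
    rw [← Complex.hasSum_ofReal]
    simpa only [Complex.ofReal_mul, Complex.ofReal_div, Complex.ofReal_ofNat] using
      hasSum_of_tendsto_of_dominated (summable_linear_mul_geometric 132 27 (by norm_num))
        tendsto_termB₀ (hev.mono fun q hq => norm_termB₀_div_le hq.1 hq.2)
        (hev.mono fun q hq => (hasSum_termA₀_and_hasSum_termB₀ hq.1 hq.2).2.div_const _)
        tendsto_rhs₀
  have hvalue : 8 / 3 * (2 * √3 / Real.pi) = 16 / (√3 * Real.pi) := by
    field_simp
    rw [Real.sq_sqrt zero_le_three]
    norm_num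
  rw [← hvalue]
  exact (hscaled.mul_left (8 / 3)).congr_fun fun n => by ring

end ClassicalSeries

theorem mainTheorem6 :
    -- the two-variable formulas
    (∀ (q : ℝ), 0 < q → q < 1 → ∀ (b c : ℂ),
      (∀ j : ℕ, (q : ℂ) ^ (3 * c + 3 + 3 * j) ≠ 1) →
      (∀ j : ℕ, (q : ℂ) ^ (6 * b + 3 * c + 3 + 3 * j) ≠ 1) →
      (∀ j : ℕ, (q : ℂ) ^ (3 * b + 3 * c + 3 / 2 + 3 * j) ≠ 1) →
        -- the `8n+1` series
        (Summable (auxA q b) ∧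
          HasSum (termA q b c)
            ((1 - q) * ((q : ℂ) ^ 2 + q + 1) ^ (3 * b + 3 * c + 1 / 2) *
            qGamma (q ^ 3) (c + 1) * qGamma (q ^ 3) (b + c + 1 / 2) *
            qGamma (q ^ 3) (2 * b + c + 1) /
            (qGamma (q ^ 3) (1 / 3) * qGamma (q ^ 3) (2 / 3) *
            qGamma q (3 * b + 3 * c + 1 / 2)) *
            ∑' n, auxA q b n)) ∧
        HasSum (termA q b c)
          ((1 - q) * ((q : ℂ) ^ 2 + q + 1) ^ (3 * b + 3 * c + 1 / 2) *
            qGamma (q ^ 3) (c + 1) * qGamma (q ^ 3) (b + c + 1 / 2) *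
            qGamma (q ^ 3) (2 * b + c + 1) /
            (qGamma (q ^ 3) (1 / 2 - b) * qGamma (q ^ 3) (b + 1 / 2) *
            qGamma q (3 * b + 3 * c + 1 / 2))) ∧
        -- the `28n+3` series
        ((∀ n : ℕ, (q : ℂ) ^ (2 * b + 2 * c + 1) ≠ (q : ℂ) ^ (-b - c + 3 * n - 1 / 2)) →
          (Summable (auxB q b) ∧
            HasSum (fun n => (q : ℂ) ^ (-(5 / 2) : ℂ) * termB q b c n)
            ((1 - q) * ((q : ℂ) ^ 2 + q + 1) ^ (3 * b + 3 * c + 1 / 2) *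
            qGamma (q ^ 3) (c + 1) * qGamma (q ^ 3) (b + c + 1 / 2) *
            qGamma (q ^ 3) (2 * b + c + 1) /
            (qGamma (q ^ 3) (1 / 3) * qGamma (q ^ 3) (2 / 3) *
            qGamma q (3 * b + 3 * c + 1 / 2)) *
            ∑' n, auxB q b n)) ∧
          HasSum (termB q b c)
          ((q : ℂ) ^ (3 * b + 3) *
            ((1 - q) * ((q : ℂ) ^ 2 + q + 1) ^ (3 * b + 3 * c + 1 / 2) *
            qGamma (q ^ 3) (c + 1) * qGamma (q ^ 3) (b + c + 1 / 2) *
            qGamma (q ^ 3) (2 * b + c + 1)) /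
            (qGamma (q ^ 3) (1 / 2 - b) * qGamma (q ^ 3) (b + 1 / 2) *
            qGamma q (3 * b + 3 * c + 1 / 2))))) ∧
    -- the case `b = c = 0`, with `q ^ 2` in place of `q`
    (∀ (q : ℝ), 0 < q → q < 1 →
      HasSum (fun n => termA₀ q n) (rhs₀ q) ∧ HasSum (fun n => termB₀ q n) (rhs₀ q)) ∧
    -- these are `q`-analogues: as `q → 1⁻`, summands and values tend to the classical ones
    (∀ n : ℕ, Tendsto (fun q : ℝ => termA₀ q n / (1 - q)) (𝓝[<] 1) (𝓝 (classicalA n))) ∧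
    (∀ n : ℕ, Tendsto (fun q : ℝ => termB₀ q n / (1 - q)) (𝓝[<] 1)
      (𝓝 (3 / 8 * classicalB n))) ∧
    Tendsto (fun q : ℝ => rhs₀ q / (1 - q)) (𝓝[<] 1) (𝓝 ((2 * √3 / Real.pi : ℝ) : ℂ)) ∧
    HasSum classicalA (2 * √3 / Real.pi) ∧
    HasSum classicalB (16 / (√3 * Real.pi)) := by
  exact ⟨fun q hq hq1 b c h₁ h₂ h₃ => two_variable_formulas hq hq1 h₁ h₂ h₃,
    fun q hq hq1 => hasSum_termA₀_and_hasSum_termB₀ hq hq1, tendsto_termA₀, tendsto_termB₀,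
    tendsto_rhs₀, hasSum_classicalA, hasSum_classicalB⟩
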